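/- Let $m\ge 1$, $J_1,\dots,J_m>0$, $0<\lambda_1,\dots,\lambda_m<1$, and let $\beta\in\mathbb C$, $\beta\ne 0$. Put $\gamma_l=-\log\lambda_l$, $\Lambda=\mathrm{diag}(\lambda_1,\dots,\lambda_m)$, $\underline\lambda=(\lambda_1,\dots,\lambda_m)$. Let $\sqrt{\beta J_l}$ be the principal square root, write $\sqrt{\pi/(\beta J_l)}:=\sqrt\pi/\sqrt{\beta J_l}$, and let $c_\beta(\xi)=\cosh\big(\sum_{l}\sqrt{\beta J_l}\,\xi_l\big)$ for $\xi\in\mathbb R^m$, with principal square root $\sqrt{c_\beta(\xi)}$. Further let $$\widetilde{\mathcal K}(\xi,\eta)=2\prod_{l=1}^m\Big(\frac1{4\pi\sinh\gamma_l}\Big)^{1/2}\exp\Big(-\frac14\sum_{l=1}^m\Big((\xi_l^2+\eta_l^2)\tanh\frac{\gamma_l}2+\frac{(\xi_l-\eta_l)^2}{\sinh\gamma_l}\Big)\Big),\qquad n_\beta=\prod_{l=1}^m\lambda_l^{-1/2}e^{-\beta J_l/2}.$$ Let $\mathcal F$ be the space of entire functions $F:\mathbb C^m\to\mathbb C$ with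 $\|F\|^2=\int_{\mathbb C^m}|F(z)|^2\exp\big(-|\beta|\sum_l J_l|z_l|^2\big)\,dz<\infty$ (the weighted Fock space $\mathcal F_m^{\alpha_0^{-1}}$ with $\alpha_{0,l}=\sqrt{\pi/(\beta J_l)}$). **Theorem 1.** (1) The Ruelle operator $$(\mathcal L_\beta F)(z)=e^{\beta J\cdot z}F(\Lambda z+\underline\lambda)+e^{-\beta J\cdot z}F(\Lambda z-\underline\lambda)$$ is a bounded operator on $\mathcal F$, the modified Kac–Gutzwiller operator $\widetilde{\mathcal G}_\beta$ with kernel $n_\beta\,c_\beta(\xi)\,\widetilde{\mathcal K}(\xi,\eta)$ is a bounded integral operator on $L^2(\mathbb R^m)$, and the two operators have the same spectrum. (2) If $\beta$ is real, the rescaled Kac–Gutzwiller operator $\mathcal G_\beta$ with kernel $n_\beta\sqrt{c_\beta(\xi)}\sqrt{c_\beta(\eta)}\,\widetilde{\mathcal K}(\xi,\eta)$ is a bounded integral operator on $L^2(\mathbb R^m)$, and it also has this spectrum. (3) Let $\beta$ be real and $\rho\ne 0$. The eigenfunctions $F\in\mathcal F$ of $\mathcal L_\beta$ with eigenvalue $\rho$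 and the eigenfunctions $f\in L^2(\mathbb R^m)$ of $\mathcal G_\beta$ with eigenvalue $\rho$ correspond to each other under the following two mutually inverse formulas, in which the integrals converge absolutely ($z^*$ denotes the complex conjugate of $z$, and $x^2=\sum_l x_l^2$, $z^{*2}=\sum_l (z_l^*)^2$): $$f(\xi)=\Big(\frac1{2\pi}\Big)^{m/4}\frac1{\sqrt{c_\beta(\xi)}}\int_{\mathbb C^m}F\Big(\sqrt{\tfrac{\pi}{\beta J_1}}\,z_1,\dots,\sqrt{\tfrac{\pi}{\beta J_m}}\,z_m\Big)\exp\Big(\sqrt\pi\,\xi\cdot z^*-\frac14\xi^2-\frac\pi2z^{*2}-\pi|z|^2\Big)dz$$ for almost every $\xi\in\mathbb R^m$, and $$F(z)=(8\pi)^{m/4}\int_{\mathbb R^m}\sqrt{c_\beta(2\sqrt\pi\,x)}\,f(2\sqrt\pi\,x)\exp\Big(2\sqrt\pi\sum_{l=1}^m\sqrt{\beta J_l}\,x_lz_l-\pi x^2-\frac\beta2\sum_{l=1}^mJ_lz_l^2\Big)dx$$ for every $z\in\mathbb C^m$. -/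

import Mathlib

open MeasureTheory

noncomputable section

/-- The Gaussian weight `exp (-π ∑ |α_l z_l|²)` times Lebesgue measure on `ℂ^m`. -/
def fockMeasure {m : ℕ} (α : Fin m → ℂ) : Measure (Fin m → ℂ) :=
  volume.withDensity fun z => ENNReal.ofReal (Real.exp (-(Real.pi * ∑ l, ‖α l * z l‖ ^ 2)))

/-- The entire functions on `ℂ^m` that are square integrable for `fockMeasure α`. -/
def fockSubmodule {m : ℕ} (α : Fin m → ℂ) : Submodule ℂ ((Fin m → ℂ) → ℂ) where
  carrier := {F | Differentiable ℂ F ∧ MemLp F 2 (fockMeasure α)}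
  add_mem' hF hG := ⟨hF.1.add hG.1, hF.2.add hG.2⟩
  zero_mem' := ⟨differentiable_const 0, MemLp.zero⟩
  smul_mem' c _ hF := ⟨hF.1.const_smul c, hF.2.const_smul c⟩

/-- The weighted Fock space `F_m^α`, normed by
`‖F‖² = ∫ |F z|² exp (-π ∑ |α_l z_l|²) dz` (see the instances below). It is a type of its own,
so that it does not carry the topology of pointwise convergence. -/
def Fock {m : ℕ} (α : Fin m → ℂ) : Type := fockSubmodule α

namespace Fock

variable {m : ℕ} {α : Fin m → ℂ}

instance : AddCommGroup (Fock α) := inferInstanceAs (AddCommGroup (fockSubmodule α))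

instance : Module ℂ (Fock α) := inferInstanceAs (Module ℂ (fockSubmodule α))

/-- An element of the Fock space as a function on `ℂ^m`. -/
def fn (α : Fin m → ℂ) : Fock α →ₗ[ℂ] ((Fin m → ℂ) → ℂ) := (fockSubmodule α).subtype

instance : CoeFun (Fock α) fun _ => (Fin m → ℂ) → ℂ := ⟨fun F => fn α F⟩

theorem differentiable (F : Fock α) : Differentiable ℂ (fn α F) := F.2.1

theorem memLp (F : Fock α) : MemLp (fn α F) 2 (fockMeasure α) := F.2.2

theorem fn_injective (α : Fin m → ℂ) : Function.Injective (fn α) := Subtype.val_injective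

/-- The inclusion of the Fock space into the space `L²` of its weight. -/
def toL2 (α : Fin m → ℂ) : Fock α →ₗ[ℂ] Lp ℂ 2 (fockMeasure α) where
  toFun F := F.memLp.toLp (fn α F)
  map_add' _ _ := rfl
  map_smul' _ _ := rfl

theorem toL2_injective (α : Fin m → ℂ) : Function.Injective (toL2 α) := by
  intro F G h
  have h1 : fn α F =ᵐ[fockMeasure α] fn α G := (MemLp.toLp_eq_toLp_iff F.memLp G.memLp).1 h
  have h2 : (volume : Measure (Fin m → ℂ)) ≪ fockMeasure α := by
    refine withDensity_absolutelyContinuous'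
      (ENNReal.continuous_ofReal.comp (by fun_prop)).aemeasurable (Filter.Eventually.of_forall ?_)
    intro z
    simp [Real.exp_pos]
  exact fn_injective α ((Continuous.ae_eq_iff_eq volume F.differentiable.continuous
    G.differentiable.continuous).1 (h2.ae_eq h1))

instance : NormedAddCommGroup (Fock α) :=
  NormedAddCommGroup.induced (Fock α) (Lp ℂ 2 (fockMeasure α)) (toL2 α) (toL2_injective α)

instance : NormedSpace ℂ (Fock α) :=
  NormedSpace.induced ℂ (Fock α) (Lp ℂ 2 (fockMeasure α)) (toL2 α)

end Fock

namespace KacBaker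

variable {m : ℕ}

/-- The square root `√(β J_l)` (principal branch). -/
def rootCoupling (β : ℂ) (J : Fin m → ℝ) (l : Fin m) : ℂ := (β * J l).sqrt

/-- The weight parameter `α₀⁻¹ = (√(β J_l / π))_l`; its inverse is `α₀ = (√(π / (β J_l)))_l`. -/
def invAlpha (β : ℂ) (J : Fin m → ℝ) (l : Fin m) : ℂ := rootCoupling β J l / √Real.pi

/-- `L` is the Ruelle operator
`(L F)(z) = e^{β J·z} F(Λ z + lam) + e^{-β J·z} F(Λ z - lam)` on the Fock space `F_m^α`. -/
def IsRuelleOperator (lam J : Fin m → ℝ) (β : ℂ) {α : Fin m → ℂ} (L : Fock α →L[ℂ] Fock α) :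
    Prop :=
  ∀ (F : Fock α) (z : Fin m → ℂ),
    L F z = Complex.exp (β * ∑ l, J l * z l) * F (fun l => lam l * z l + lam l) +
      Complex.exp (-(β * ∑ l, J l * z l)) * F (fun l => lam l * z l - lam l)

/-- The complex Hilbert space `L²(ℝ^m)` for Lebesgue measure. -/
abbrev L2 (m : ℕ) : Type := Lp ℂ 2 (volume : Measure (Fin m → ℝ))

/-- `T` is the integral operator `(T f)(ξ) = ∫ k(ξ, η) f(η) dη` on `L²(ℝ^m)`. -/
def IsIntegralOperator (k : (Fin m → ℝ) → (Fin m → ℝ) → ℂ) (T : L2 m →L[ℂ] L2 m) : Prop :=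
  ∀ f : L2 m, (∀ᵐ ξ, Integrable fun η => k ξ η * f η) ∧ T f =ᵐ[volume] fun ξ => ∫ η, k ξ η * f η

/-- `γ` with `e^{-γ} = lam`. -/
def decay (lam : ℝ) : ℝ := -Real.log lam

/-- `exp (-¼ ∑ ((ξ_l² + η_l²) tanh (γ_l / 2) + (ξ_l - η_l)² / sinh γ_l))`. -/
def gaussian (lam : Fin m → ℝ) (ξ η : Fin m → ℝ) : ℝ :=
  Real.exp (-(1 / 4) * ∑ l, ((ξ l ^ 2 + η l ^ 2) * Real.tanh (decay (lam l) / 2) +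
    (ξ l - η l) ^ 2 / Real.sinh (decay (lam l))))

/-- The kernel `K̃(ξ, η)`. -/
def kernelTilde (lam : Fin m → ℝ) (ξ η : Fin m → ℝ) : ℝ :=
  2 * (∏ l, √(1 / (4 * Real.pi * Real.sinh (decay (lam l))))) * gaussian lam ξ η

/-- `cosh (∑ √(β J_l) ξ_l)`. -/
def coshRoot (β : ℂ) (J : Fin m → ℝ) (ξ : Fin m → ℝ) : ℂ :=
  Complex.cosh (∑ l, rootCoupling β J l * ξ l)

/-- The square root of `cosh (∑ √(β J_l) ξ_l)`, principal branch. For `β ≥ 0` it is the positive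
root of a number `≥ 1`; for `β < 0` the hyperbolic cosine is a cosine, which can be negative. -/
def sqrtCoshRoot (β : ℂ) (J : Fin m → ℝ) (ξ : Fin m → ℝ) : ℂ := (coshRoot β J ξ).sqrt

/-- The normalising factor `∏ (lam_l exp (β J_l))^{-1/2} = ∏ lam_l^{-1/2} exp (-β J_l / 2)`. -/
def normalization (lam J : Fin m → ℝ) (β : ℂ) : ℂ :=
  ∏ l, ((√(lam l))⁻¹ : ℝ) * Complex.exp (-(β * J l / 2))

/-- The kernel of the modified Kac–Gutzwiller operator `G̃_β`. -/
def kernelModified (lam J : Fin m → ℝ) (β : ℂ) (ξ η : Fin m → ℝ) : ℂ :=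
  normalization lam J β * coshRoot β J ξ * kernelTilde lam ξ η

/-- The kernel of the Kac–Gutzwiller operator `K_β`. -/
def kernelKac (lam J : Fin m → ℝ) (β : ℂ) (ξ η : Fin m → ℝ) : ℂ :=
  sqrtCoshRoot β J ξ * sqrtCoshRoot β J η /
    ((2 ^ ((m : ℤ) - 1) * ∏ l, √(Real.pi * Real.sinh (decay (lam l))) : ℝ) : ℂ) *
    gaussian lam ξ η

/-- The kernel of the rescaled Kac–Gutzwiller operator `G_β`. -/
def kernelRescaled (lam J : Fin m → ℝ) (β : ℂ) (ξ η : Fin m → ℝ) : ℂ :=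
  normalization lam J β * kernelKac lam J β ξ η

/-- The integrand (in `z ∈ ℂ^m`) of the integral giving `f(ξ)` from `F`:
`F(√(π/(β J_1)) z_1, …) exp (√π ξ·z* - ξ²/4 - (π/2) z*² - π |z|²)`. -/
def kacIntegrand (J : Fin m → ℝ) (β : ℂ) (F : (Fin m → ℂ) → ℂ) (ξ : Fin m → ℝ)
    (z : Fin m → ℂ) : ℂ :=
  F (fun l => (invAlpha β J l)⁻¹ * z l) *
    Complex.exp (√Real.pi * (∑ l, ξ l * star (z l)) - (1 / 4) * (∑ l, (ξ l : ℂ) ^ 2) -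
      Real.pi / 2 * (∑ l, star (z l) ^ 2) - Real.pi * (∑ l, (‖z l‖ : ℂ) ^ 2))

/-- The function `f` on `ℝ^m` assigned to a function `F` on `ℂ^m`. -/
def toKac (J : Fin m → ℝ) (β : ℂ) (F : (Fin m → ℂ) → ℂ) (ξ : Fin m → ℝ) : ℂ :=
  (((1 / (2 * Real.pi)) ^ ((m : ℝ) / 4) : ℝ) : ℂ) * (1 / sqrtCoshRoot β J ξ) *
    ∫ z, kacIntegrand J β F ξ z

/-- The integrand (in `x ∈ ℝ^m`) of the integral giving `F(z)` from `f`: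
`√(cosh (2 √π ∑ √(β J_l) x_l)) f(2 √π x)
  exp (2 √π ∑ √(β J_l) x_l z_l - π x² - (β/2) ∑ J_l z_l²)`. -/
def ruelleIntegrand (J : Fin m → ℝ) (β : ℂ) (f : (Fin m → ℝ) → ℂ) (z : Fin m → ℂ)
    (x : Fin m → ℝ) : ℂ :=
  sqrtCoshRoot β J (fun l => 2 * √Real.pi * x l) * f (fun l => 2 * √Real.pi * x l) *
    Complex.exp (2 * √Real.pi * (∑ l, rootCoupling β J l * x l * z l) -
      Real.pi * (∑ l, (x l : ℂ) ^ 2) - β / 2 * (∑ l, J l * z l ^ 2))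

/-- The function `F` on `ℂ^m` assigned to a function `f` on `ℝ^m`. -/
def toRuelle (J : Fin m → ℝ) (β : ℂ) (f : (Fin m → ℝ) → ℂ) (z : Fin m → ℂ) : ℂ :=
  (((8 * Real.pi) ^ ((m : ℝ) / 4) : ℝ) : ℂ) * ∫ x, ruelleIntegrand J β f z x

end KacBaker

end

noncomputable section

/-! ### Uniqueness for the Fourier transform of integrable functions -/

section FourierUniqueness

variable {m : ℕ}

/-! The bridge between the two operators is the Bargmann transform with scale `s_l = √(β J_l)`, `(B
g)(z) = (2π)^{-m/4} ∫ κ_{sz}(ξ) g(ξ) dξ` with `κ_t(ξ) = exp (t·ξ - ξ²/4 - t²/2)`. It maps `L²(ℝ^m)`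
onto the Fock space and multiplies norms by a constant. The conjugates of the `κ_t` (coherent
states) have the Fock reproducing kernel as their Gram matrix, so `B` sends them to multiples of
reproducing kernels; they span a dense subspace, because for imaginary `t` they are Gaussians times
characters.

A Gaussian integral (`integral_bargmannKernel_mul_gaussian`) shows that integrating `κ_{sz}(ξ)
e^{±s·ξ}` against the Gaussian part of the Kac kernel gives `e^{±β J·z} κ_{s(Λz ± lam)}(η)`, up to
constants that `normalization` cancels. As `cosh` is half the sum of the two exponentials, `B G̃ = L
B` (`bargmann_modified`). So `L` can be defined as `B G̃ B⁻¹`; boundedness and equality of the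
spectra come with the definition.

With `c` the hyperbolic cosine and `K` the Gaussian kernel, `√c K √c` and `c K` differ by moving the
factor `√c` from one side to the other. Their nonzero spectra agree by the rule for products `AB`
and `BA`, applied after distributing a Gaussian so that every factor is bounded; `0` lies in both
spectra because both ranges lie in `w · L²` for a square integrable `w`
(`spectrum_kernelRescaled_eq`).

For `ρ ≠ 0` the eigenfunctions are matched by `g = √c f`, `F = B g`. The formula for `F` is `B`
after rescaling the variable. The formula for `f` is the adjoint of `B` written as an integral. For
general `F` in the Fock space that integral sits exactly at the borderline of convergence, but the
equation `ρ F = L F` improves the growth of `F`, since `L` evaluates `F` at contracted arguments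
(`exists_norm_apply_le_of_eigen`). Absolute convergence, Fubini and Fourier uniqueness then give the
inversion (`bargmannConst_mul_integral_kacIntegrand`). -/

theorem integrable_mul_cexp_dot {h : (Fin m → ℝ) → ℂ} (hh : Integrable h) (y : Fin m → ℝ) :
    Integrable fun ξ => h ξ * Complex.exp (Complex.I * ∑ l, (y l : ℂ) * ξ l) := by
  refine hh.mul_bdd (c := 1) (by
    have : Continuous fun ξ : Fin m → ℝ =>
      Complex.exp (Complex.I * ∑ l, (y l : ℂ) * ξ l) := by fun_prop
    exact this.aestronglyMeasurable) (Filter.Eventually.of_forall fun ξ => ?_)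
  rw [Complex.norm_exp]
  have : (Complex.I * ∑ l, (y l : ℂ) * ξ l) = ((∑ l, y l * ξ l : ℝ) : ℂ) * Complex.I := by
    push_cast; ring
  rw [this]
  simp

/-- The positive and negative parts of `u` are densities of finite measures with the same
characteristic function; such measures coincide, so both parts agree almost everywhere, and both
vanish. -/
theorem ae_eq_zero_of_forall_integral_ofReal_mul_cexp_eq_zero {u : (Fin m → ℝ) → ℝ}
    (hu : Integrable u)
    (H : ∀ y : Fin m → ℝ, ∫ ξ, (u ξ : ℂ) * Complex.exp (Complex.I * ∑ l, (y l : ℂ) * ξ l) = 0) :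
    u =ᵐ[volume] 0 := by
  have hfin : ∀ {v : (Fin m → ℝ) → ℝ}, Integrable v →
      IsFiniteMeasure (volume.withDensity fun ξ => ENNReal.ofReal (v ξ)) := fun hv =>
    isFiniteMeasure_withDensity_ofReal hv.2
  have := hfin hu
  have := hfin hu.neg
  have key : ∀ {v : (Fin m → ℝ) → ℝ} (_ : Integrable v) (Λ : StrongDual ℝ (Fin m → ℝ)),
      charFunDual (volume.withDensity fun ξ => ENNReal.ofReal (v ξ)) Λ =
        ∫ ξ, ((max (v ξ) 0 : ℝ) : ℂ) *
          Complex.exp (Complex.I * ∑ l, ((Λ (Pi.single l 1) : ℝ) : ℂ) * ξ l) := by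
    intro v hv Λ
    rw [charFunDual_apply, integral_withDensity_eq_integral_toReal_smul₀
      hv.aemeasurable.ennreal_ofReal (Filter.Eventually.of_forall fun _ => ENNReal.ofReal_lt_top)]
    refine integral_congr_ae (Filter.Eventually.of_forall fun ξ => ?_)
    have h1 : Λ ξ = ∑ l, Λ (Pi.single l 1) * ξ l := by
      conv_lhs => rw [← Finset.univ_sum_single ξ, map_sum]
      refine Finset.sum_congr rfl fun l _ => ?_
      have : (Pi.single l (ξ l) : Fin m → ℝ) = ξ l • Pi.single l 1 := by
        rw [← Pi.single_smul]; simp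
      rw [this, map_smul, smul_eq_mul, mul_comm]
    simp only [ENNReal.toReal_ofReal', Complex.real_smul, h1]
    push_cast
    rw [mul_comm Complex.I]
  have heq : (volume.withDensity fun ξ => ENNReal.ofReal (u ξ)) =
      volume.withDensity fun ξ => ENNReal.ofReal ((-u) ξ) := by
    refine Measure.ext_of_charFunDual (funext fun Λ => ?_)
    rw [key hu, key hu.neg, ← sub_eq_zero, ← integral_sub]
    · rw [← H fun l => Λ (Pi.single l 1)]
      refine integral_congr_ae (Filter.Eventually.of_forall fun ξ => ?_)
      simp only [← sub_mul, ← Complex.ofReal_sub, Pi.neg_apply]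
      congr 2
      rcases le_total 0 (u ξ) with h | h
      · rw [max_eq_left h, max_eq_right (by linarith)]; ring
      · rw [max_eq_right h, max_eq_left (by linarith)]; ring
    · exact integrable_mul_cexp_dot hu.pos_part.ofReal _
    · exact integrable_mul_cexp_dot hu.neg.pos_part.ofReal _
  rw [withDensity_eq_iff_of_sigmaFinite hu.aemeasurable.ennreal_ofReal
    hu.neg.aemeasurable.ennreal_ofReal] at heq
  filter_upwards [heq] with ξ h
  rcases le_total 0 (u ξ) with h0 | h0
  · rw [ENNReal.ofReal_of_nonpos (p := (-u) ξ) (by simpa using h0), ENNReal.ofReal_eq_zero] at h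
    exact le_antisymm h h0
  · rw [ENNReal.ofReal_of_nonpos h0, eq_comm, ENNReal.ofReal_eq_zero] at h
    exact le_antisymm h0 (by simpa using h)

theorem ae_eq_zero_of_forall_integral_mul_cexp_eq_zero {h : (Fin m → ℝ) → ℂ} (hh : Integrable h)
    (H : ∀ y : Fin m → ℝ, ∫ ξ, h ξ * Complex.exp (Complex.I * ∑ l, (y l : ℂ) * ξ l) = 0) :
    h =ᵐ[volume] 0 := by
  -- Conjugation turns the frequency `y` into `-y`, so the conjugate of `h` has vanishing transform
  -- too, and hence so do the real and imaginary parts.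
  have hc : Integrable fun ξ => star (h ξ) :=
    Complex.conjCLE.toContinuousLinearMap.integrable_comp hh
  have Hc : ∀ y : Fin m → ℝ,
      ∫ ξ, star (h ξ) * Complex.exp (Complex.I * ∑ l, (y l : ℂ) * ξ l) = 0 := by
    intro y
    have h1 := congrArg (starRingEnd ℂ) (H (-y))
    rw [← integral_conj, map_zero] at h1
    rw [← h1]
    refine integral_congr_ae (Filter.Eventually.of_forall fun ξ => ?_)
    simp [← Complex.exp_conj]
  have hre : (fun ξ => (h ξ).re) =ᵐ[volume] 0 := by
    refine ae_eq_zero_of_forall_integral_ofReal_mul_cexp_eq_zero hh.re fun y => ?_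
    have h1 : ∀ ξ, ((h ξ).re : ℂ) * Complex.exp (Complex.I * ∑ l, (y l : ℂ) * ξ l) =
        (1 / 2) * (h ξ * Complex.exp (Complex.I * ∑ l, (y l : ℂ) * ξ l) +
          star (h ξ) * Complex.exp (Complex.I * ∑ l, (y l : ℂ) * ξ l)) := by
      intro ξ
      rw [Complex.re_eq_add_conj]; simp only [Complex.star_def]; ring
    simp_rw [h1]
    rw [integral_const_mul, integral_add (integrable_mul_cexp_dot hh y)
      (integrable_mul_cexp_dot hc y), H, Hc]
    simp
  have him : (fun ξ => (h ξ).im) =ᵐ[volume] 0 := by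
    refine ae_eq_zero_of_forall_integral_ofReal_mul_cexp_eq_zero hh.im fun y => ?_
    have h1 : ∀ ξ, ((h ξ).im : ℂ) * Complex.exp (Complex.I * ∑ l, (y l : ℂ) * ξ l) =
        (1 / (2 * Complex.I)) * (h ξ * Complex.exp (Complex.I * ∑ l, (y l : ℂ) * ξ l) -
          star (h ξ) * Complex.exp (Complex.I * ∑ l, (y l : ℂ) * ξ l)) := by
      intro ξ
      rw [Complex.im_eq_sub_conj]; simp only [Complex.star_def]; ring
    simp_rw [h1]
    rw [integral_const_mul, integral_sub (integrable_mul_cexp_dot hh y)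
      (integrable_mul_cexp_dot hc y), H, Hc]
    simp
  filter_upwards [hre, him] with ξ h1 h2
  exact Complex.ext h1 h2

end FourierUniqueness

/-! ### Integral operators and multiplication operators on `L²` -/

namespace KacBaker

variable {m : ℕ}

theorem integrable_kernel_mul {k : (Fin m → ℝ) → (Fin m → ℝ) → ℂ}
    (hk : StronglyMeasurable (Function.uncurry k)) {u v : (Fin m → ℝ) → ℝ}
    (hv : MemLp v 2) (hb : ∀ ξ η, ‖k ξ η‖ ≤ u ξ * v η) (f : L2 m) (ξ : Fin m → ℝ) :
    Integrable fun η => k ξ η * f η := by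
  have h1 : Integrable fun η => v η * ‖f η‖ := hv.integrable_mul (Lp.memLp f).norm
  refine (h1.const_mul (u ξ)).mono' ?_ (Filter.Eventually.of_forall fun η => ?_)
  · exact (hk.comp_measurable measurable_prodMk_left).aestronglyMeasurable.mul
      (Lp.aestronglyMeasurable f)
  · rw [norm_mul, ← mul_assoc]
    gcongr
    exact hb ξ η

theorem integral_mul_norm_le {v : (Fin m → ℝ) → ℝ} (hv : MemLp v 2) (f : L2 m) :
    ∫ η, ‖v η‖ * ‖f η‖ ≤ (eLpNorm v 2).toReal * ‖f‖ := by
  have h := eLpNorm_smul_le_mul_eLpNorm (p := 2) (q := 2) (r := 1) (Lp.memLp f).1 hv.1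
  have h2 := ENNReal.toReal_mono (ENNReal.mul_ne_top hv.2.ne (Lp.memLp f).2.ne) h
  rw [ENNReal.toReal_mul, ← Lp.norm_def] at h2
  refine le_trans (le_of_eq ?_) h2
  rw [eLpNorm_one_eq_lintegral_enorm, ← integral_norm_eq_lintegral_enorm]
  · simp
  · exact hv.1.smul (Lp.memLp f).1

/-- By Cauchy–Schwarz `|(T f)(ξ)| ≤ |u ξ| ‖v‖ ‖f‖`, which is square integrable in `ξ`. The
domination holds for every `ξ`, so no exceptional set arises. -/
theorem exists_isIntegralOperator {k : (Fin m → ℝ) → (Fin m → ℝ) → ℂ}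
    (hk : StronglyMeasurable (Function.uncurry k)) {u v : (Fin m → ℝ) → ℝ}
    (hu : MemLp u 2) (hv : MemLp v 2) (hb : ∀ ξ η, ‖k ξ η‖ ≤ u ξ * v η) :
    ∃ T : L2 m →L[ℂ] L2 m, IsIntegralOperator k T := by
  have hint := integrable_kernel_mul hk hv hb
  have hbd : ∀ (f : L2 m) ξ, ‖∫ η, k ξ η * f η‖ ≤ ((eLpNorm v 2).toReal * ‖f‖) * ‖u ξ‖ := by
    intro f ξ
    refine (norm_integral_le_integral_norm _).trans ?_
    have h1 : Integrable fun η => ‖v η‖ * ‖f η‖ := hv.norm.integrable_mul (Lp.memLp f).norm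
    calc ∫ η, ‖k ξ η * f η‖ ≤ ∫ η, ‖u ξ‖ * (‖v η‖ * ‖f η‖) := by
          refine integral_mono (hint f ξ).norm (h1.const_mul _) fun η => ?_
          dsimp only
          rw [norm_mul, ← mul_assoc, ← norm_mul (u ξ)]
          exact mul_le_mul_of_nonneg_right ((hb ξ η).trans (le_abs_self _)) (norm_nonneg (f η))
      _ = ‖u ξ‖ * ∫ η, ‖v η‖ * ‖f η‖ := integral_const_mul _ _
      _ ≤ _ := by
          rw [mul_comm]
          gcongr
          exact integral_mul_norm_le hv f
  have hmem : ∀ f : L2 m, MemLp (fun ξ => ∫ η, k ξ η * f η) 2 := by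
    intro f
    have h1 : StronglyMeasurable fun p : (Fin m → ℝ) × (Fin m → ℝ) => f p.2 :=
      (Lp.stronglyMeasurable f).comp_measurable measurable_snd
    have h2 : StronglyMeasurable fun p : (Fin m → ℝ) × (Fin m → ℝ) => k p.1 p.2 * f p.2 :=
      StronglyMeasurable.mul hk h1
    have h3 : AEStronglyMeasurable fun ξ => ∫ η, k ξ η * f η :=
      h2.integral_prod_right'.aestronglyMeasurable
    exact MemLp.of_le_mul hu h3 (Filter.Eventually.of_forall fun ξ => hbd f ξ)
  let T : L2 m →ₗ[ℂ] L2 m :=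
    { toFun := fun f => (hmem f).toLp _
      map_add' := by
        intro f g
        rw [← MemLp.toLp_add, MemLp.toLp_eq_toLp_iff]
        refine Filter.Eventually.of_forall fun ξ => ?_
        rw [Pi.add_apply, ← integral_add (hint f ξ) (hint g ξ)]
        refine integral_congr_ae ?_
        filter_upwards [Lp.coeFn_add f g] with η h
        rw [h, Pi.add_apply, mul_add]
      map_smul' := by
        intro c f
        rw [RingHom.id_apply, ← MemLp.toLp_const_smul, MemLp.toLp_eq_toLp_iff]
        refine Filter.Eventually.of_forall fun ξ => ?_
        rw [Pi.smul_apply, ← integral_smul]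
        refine integral_congr_ae ?_
        filter_upwards [Lp.coeFn_smul c f] with η h
        rw [h, Pi.smul_apply, smul_eq_mul, smul_eq_mul]; ring }
  refine ⟨T.mkContinuous ((eLpNorm v 2).toReal * ‖hu.toLp u‖) fun f => ?_, fun f =>
    ⟨Filter.Eventually.of_forall (hint f), ?_⟩⟩
  · have := Lp.norm_le_mul_norm_of_ae_le_mul (f := T f) (g := hu.toLp u)
      (c := (eLpNorm v 2).toReal * ‖f‖) (by
        filter_upwards [(hmem f).coeFn_toLp, hu.coeFn_toLp] with ξ h1 h2
        rw [h2]
        change ‖((hmem f).toLp _ : L2 m) ξ‖ ≤ _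
        rw [h1]
        exact hbd f ξ)
    linarith
  · exact (hmem f).coeFn_toLp

theorem exists_mulOperator {φ : (Fin m → ℝ) → ℂ} (hφ : AEStronglyMeasurable φ) {C : ℝ}
    (hC : ∀ ξ, ‖φ ξ‖ ≤ C) :
    ∃ M : L2 m →L[ℂ] L2 m, ∀ f : L2 m, M f =ᵐ[volume] fun ξ => φ ξ * f ξ := by
  have hbd : ∀ (f : L2 m) ξ, ‖φ ξ * f ξ‖ ≤ C * ‖f ξ‖ := fun f ξ => by
    rw [norm_mul]; gcongr; exact hC ξ
  have hmem : ∀ f : L2 m, MemLp (fun ξ => φ ξ * f ξ) 2 := fun f =>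
    MemLp.of_le_mul (Lp.memLp f) (hφ.mul (Lp.aestronglyMeasurable f))
      (Filter.Eventually.of_forall (hbd f))
  let T : L2 m →ₗ[ℂ] L2 m :=
    { toFun := fun f => (hmem f).toLp _
      map_add' := by
        intro f g
        rw [← MemLp.toLp_add, MemLp.toLp_eq_toLp_iff]
        filter_upwards [Lp.coeFn_add f g] with η h
        rw [h, Pi.add_apply, mul_add, Pi.add_apply]
      map_smul' := by
        intro c f
        rw [RingHom.id_apply, ← MemLp.toLp_const_smul, MemLp.toLp_eq_toLp_iff]
        filter_upwards [Lp.coeFn_smul c f] with η h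
        rw [h, Pi.smul_apply, Pi.smul_apply, smul_eq_mul, smul_eq_mul]; ring }
  refine ⟨T.mkContinuous C fun f => ?_, fun f => (hmem f).coeFn_toLp⟩
  refine Lp.norm_le_mul_norm_of_ae_le_mul ?_
  filter_upwards [(hmem f).coeFn_toLp] with ξ h1
  change ‖((hmem f).toLp _ : L2 m) ξ‖ ≤ _
  rw [h1]
  exact hbd f ξ

theorem IsIntegralOperator.ext {k : (Fin m → ℝ) → (Fin m → ℝ) → ℂ} {S T : L2 m →L[ℂ] L2 m}
    (hS : IsIntegralOperator k S) (hT : IsIntegralOperator k T) : S = T :=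
  ContinuousLinearMap.ext fun f => Lp.ext ((hS f).2.trans (hT f).2.symm)

theorem IsIntegralOperator.mul_left {k : (Fin m → ℝ) → (Fin m → ℝ) → ℂ} {M T : L2 m →L[ℂ] L2 m}
    {φ : (Fin m → ℝ) → ℂ} (hM : ∀ f : L2 m, M f =ᵐ[volume] fun ξ => φ ξ * f ξ)
    (hT : IsIntegralOperator k T) : IsIntegralOperator (fun ξ η => φ ξ * k ξ η) (M * T) := by
  intro f
  refine ⟨?_, ?_⟩
  · filter_upwards [(hT f).1] with ξ h
    simpa only [mul_assoc] using h.const_mul (φ ξ)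
  · filter_upwards [hM (T f), (hT f).2] with ξ h1 h2
    rw [mul_apply_eq_comp, h1, h2, ← integral_const_mul]
    simp only [mul_assoc]

theorem IsIntegralOperator.mul_right {k : (Fin m → ℝ) → (Fin m → ℝ) → ℂ} {M T : L2 m →L[ℂ] L2 m}
    {φ : (Fin m → ℝ) → ℂ} (hM : ∀ f : L2 m, M f =ᵐ[volume] fun ξ => φ ξ * f ξ)
    (hT : IsIntegralOperator k T) : IsIntegralOperator (fun ξ η => k ξ η * φ η) (T * M) := by
  intro f
  have h : ∀ ξ, (fun η => k ξ η * φ η * f η) =ᵐ[volume] fun η => k ξ η * M f η := fun ξ => by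
    filter_upwards [hM f] with η h
    rw [h, mul_assoc]
  refine ⟨?_, ?_⟩
  · filter_upwards [(hT (M f)).1] with ξ h1
    exact h1.congr (h ξ).symm
  · filter_upwards [(hT (M f)).2] with ξ h1
    rw [mul_apply_eq_comp, h1]
    exact integral_congr_ae (h ξ).symm

/-- Multiplication by a square integrable function is not onto in positive dimension, since the
constant `1` would have to be square integrable. -/
theorem zero_mem_spectrum_mul (hm : 0 < m) {w : (Fin m → ℝ) → ℂ} (hw : MemLp w 2)
    (hw0 : ∀ ξ, w ξ ≠ 0) {W : L2 m →L[ℂ] L2 m} (hW : ∀ f : L2 m, W f =ᵐ[volume] fun ξ => w ξ * f ξ)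
    (Z : L2 m →L[ℂ] L2 m) : (0 : ℂ) ∈ spectrum ℂ (W * Z) := by
  rw [spectrum.zero_mem_iff]
  rintro ⟨U, hU⟩
  have h1 : W (Z ((↑U⁻¹ : L2 m →L[ℂ] L2 m) (hw.toLp w))) = hw.toLp w := by
    rw [← mul_apply_eq_comp, ← mul_apply_eq_comp, ← hU,
      Units.mul_inv, one_apply_eq_self]
  set f := Z ((↑U⁻¹ : L2 m →L[ℂ] L2 m) (hw.toLp w))
  have h2 : (f : (Fin m → ℝ) → ℂ) =ᵐ[volume] fun _ => 1 := by
    have h3 := hW f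
    rw [h1] at h3
    filter_upwards [h3, hw.coeFn_toLp] with ξ h4 h5
    rw [h5] at h4
    exact mul_left_cancel₀ (hw0 ξ) (by rw [← h4, mul_one])
  have h3 : MemLp (fun _ : Fin m → ℝ => (1 : ℂ)) 2 := (memLp_congr_ae h2).1 (Lp.memLp f)
  rw [memLp_const_iff two_ne_zero ENNReal.ofNat_ne_top] at h3
  have : Nonempty (Fin m) := ⟨⟨0, hm⟩⟩
  rcases h3 with h3 | h3
  · exact one_ne_zero h3
  · rw [← Set.pi_univ, volume_pi, Measure.pi_pi] at h3
    simp [hm.ne'] at h3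

end KacBaker
end

noncomputable section

/-! ### Gaussian integrability -/

section GaussianDecay

variable {m : ℕ} {V : Type*} [NormedAddCommGroup V] [InnerProductSpace ℝ V]
  [FiniteDimensional ℝ V] [MeasurableSpace V] [BorelSpace V]

/-- Half of the quadratic term absorbs the linear one by completing the square; the other half is a
product of integrable Gaussians. -/
theorem integrable_exp_sum_neg_sq_add {a : Fin m → ℝ} (ha : ∀ l, 0 < a l) (b : Fin m → ℝ) :
    Integrable fun z : Fin m → V => Real.exp (∑ l, (-a l * ‖z l‖ ^ 2 + b l * ‖z l‖)) := by
  have h1 : ∀ l, Integrable fun z : V => Real.exp (-(a l / 2) * ‖z‖ ^ 2) := fun l => by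
    have h := (GaussianFourier.integrable_cexp_neg_mul_sq_norm_add (b := ((a l / 2 : ℝ) : ℂ))
      (V := V) (by rw [Complex.ofReal_re]; exact half_pos (ha l)) 0 0).norm
    refine h.congr (Filter.Eventually.of_forall fun z => ?_)
    dsimp only
    rw [Complex.norm_exp, zero_mul, add_zero]
    congr 1
    rw [← Complex.ofReal_neg, ← Complex.ofReal_pow, ← Complex.ofReal_mul, Complex.ofReal_re]
  have h2 : Integrable fun z : Fin m → V =>
      Real.exp (∑ l, b l ^ 2 / (2 * a l)) * ∏ l, Real.exp (-(a l / 2) * ‖z l‖ ^ 2) :=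
    (Integrable.fintype_prod h1).const_mul _
  refine h2.mono' (by
    have : Continuous fun z : Fin m → V =>
      Real.exp (∑ l, (-a l * ‖z l‖ ^ 2 + b l * ‖z l‖)) := by fun_prop
    exact this.aestronglyMeasurable) (Filter.Eventually.of_forall fun z => ?_)
  rw [Real.norm_eq_abs, Real.abs_exp, ← Real.exp_sum, ← Real.exp_add, ← Finset.sum_add_distrib]
  refine Real.exp_le_exp.2 (Finset.sum_le_sum fun l _ => ?_)
  have h3 : b l ^ 2 / (2 * a l) + -(a l / 2) * ‖z l‖ ^ 2 - (-a l * ‖z l‖ ^ 2 + b l * ‖z l‖) =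
      (b l - a l * ‖z l‖) ^ 2 / (2 * a l) := by
    have := (ha l).ne'
    field_simp; ring
  have h4 : 0 ≤ (b l - a l * ‖z l‖) ^ 2 / (2 * a l) := by have := ha l; positivity
  linarith

end GaussianDecay

/-! ### Fock space: mean value property, reproducing kernel, pointwise growth -/

variable {m : ℕ} {α : Fin m → ℂ}

/-- The sesquilinear form `π ∑ (α_l z_l) (α_l w_l)^*` whose diagonal is the exponent of the
Gaussian weight. -/
def fockPairing (α z w : Fin m → ℂ) : ℂ :=
  Real.pi * ∑ l, (α l * z l) * starRingEnd ℂ (α l * w l)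

/-- The (unnormalised) reproducing kernel of the Fock space. -/
def fockKernel (α w z : Fin m → ℂ) : ℂ := Complex.exp (fockPairing α z w)

theorem conj_fockPairing (z w : Fin m → ℂ) :
    starRingEnd ℂ (fockPairing α z w) = fockPairing α w z := by
  simp only [fockPairing, map_mul, map_sum, Complex.conj_conj, Complex.conj_ofReal]
  refine congrArg _ (Finset.sum_congr rfl fun l _ => by ring)

theorem conj_fockKernel (z w : Fin m → ℂ) :
    starRingEnd ℂ (fockKernel α w z) = fockKernel α z w := by
  rw [fockKernel, ← Complex.exp_conj, conj_fockPairing, fockKernel]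

theorem fockPairing_self (z : Fin m → ℂ) :
    fockPairing α z z = ((Real.pi * ∑ l, ‖α l * z l‖ ^ 2 : ℝ) : ℂ) := by
  simp only [fockPairing, Complex.mul_conj']
  push_cast; rfl

theorem differentiable_fockKernel (w : Fin m → ℂ) : Differentiable ℂ (fockKernel α w) := by
  unfold fockKernel fockPairing
  fun_prop

theorem integral_fockMeasure (F : (Fin m → ℂ) → ℂ) :
    ∫ z, F z ∂fockMeasure α = ∫ z, Complex.exp (-fockPairing α z z) * F z := by
  rw [fockMeasure, integral_withDensity_eq_integral_toReal_smul₀ (by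
      exact (ENNReal.continuous_ofReal.comp (by fun_prop)).aemeasurable)
    (Filter.Eventually.of_forall fun _ => ENNReal.ofReal_lt_top)]
  refine integral_congr_ae (Filter.Eventually.of_forall fun z => ?_)
  simp only [ENNReal.toReal_ofReal (Real.exp_pos _).le, Complex.real_smul, fockPairing_self]
  push_cast; rfl

theorem integrable_fockMeasure_iff {E : Type*} [NormedAddCommGroup E] [NormedSpace ℝ E]
    {F : (Fin m → ℂ) → E} :
    Integrable F (fockMeasure α) ↔
      Integrable fun z => Real.exp (-(Real.pi * ∑ l, ‖α l * z l‖ ^ 2)) • F z := by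
  rw [fockMeasure, integrable_withDensity_iff_integrable_smul₀' (by
      exact (ENNReal.continuous_ofReal.comp (by fun_prop)).aemeasurable)
    (Filter.Eventually.of_forall fun _ => ENNReal.ofReal_lt_top)]
  simp only [ENNReal.toReal_ofReal (Real.exp_pos _).le]

theorem integrable_fockMeasure_iff' {F : (Fin m → ℂ) → ℂ} :
    Integrable F (fockMeasure α) ↔
      Integrable fun z => Complex.exp (-fockPairing α z z) * F z := by
  rw [integrable_fockMeasure_iff]
  simp only [fockPairing_self, Complex.real_smul]
  push_cast; rfl

/-- The critical growth is `exp (π/2 ∑ |α_l z_l|²)`; any fraction `θ < 1` of that exponent, even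
with linear terms added, leaves Gaussian decay after squaring and weighting. -/
theorem memLp_fockMeasure_of_norm_le (hα : ∀ l, α l ≠ 0) {F : (Fin m → ℂ) → ℂ}
    (hF : Continuous F) {D : ℝ} {θ b : Fin m → ℝ} (hθ : ∀ l, θ l < 1)
    (hb : ∀ z, ‖F z‖ ≤ D * Real.exp (∑ l, (θ l * Real.pi / 2 * ‖α l * z l‖ ^ 2 + b l * ‖z l‖))) :
    MemLp F 2 (fockMeasure α) := by
  rw [memLp_two_iff_integrable_sq_norm hF.aestronglyMeasurable, integrable_fockMeasure_iff]
  have ha : ∀ l, 0 < (1 - θ l) * Real.pi * ‖α l‖ ^ 2 := fun l => by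
    have := sub_pos.2 (hθ l)
    have := norm_pos_iff.2 (hα l)
    positivity
  refine ((integrable_exp_sum_neg_sq_add (V := ℂ) ha fun l => 2 * b l).const_mul (D ^ 2)).mono'
    (Continuous.aestronglyMeasurable (by fun_prop)) (Filter.Eventually.of_forall fun z => ?_)
  rw [smul_eq_mul, Real.norm_eq_abs, abs_of_nonneg (by positivity)]
  have h1 : ‖F z‖ ^ 2 ≤
      (D * Real.exp (∑ l, (θ l * Real.pi / 2 * ‖α l * z l‖ ^ 2 + b l * ‖z l‖))) ^ 2 := by
    gcongr; exact hb z
  refine (mul_le_mul_of_nonneg_left h1 (Real.exp_pos _).le).trans (le_of_eq ?_)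
  rw [mul_pow, ← Real.exp_nat_mul, mul_left_comm, ← Real.exp_add]
  congr 2
  rw [Finset.mul_sum, Finset.mul_sum, ← Finset.sum_neg_distrib, ← Finset.sum_add_distrib]
  refine Finset.sum_congr rfl fun l _ => ?_
  rw [norm_mul]
  push_cast
  ring

theorem re_fockPairing_le (z w : Fin m → ℂ) :
    (fockPairing α z w).re ≤ ∑ l, Real.pi * ‖α l‖ * ‖α l * w l‖ * ‖z l‖ := by
  refine (Complex.re_le_norm _).trans ?_
  rw [fockPairing, norm_mul, Complex.norm_real, Real.norm_of_nonneg Real.pi_pos.le]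
  refine (mul_le_mul_of_nonneg_left (norm_sum_le _ _) Real.pi_pos.le).trans (le_of_eq ?_)
  rw [Finset.mul_sum]
  refine Finset.sum_congr rfl fun l _ => ?_
  rw [norm_mul, norm_mul, Complex.norm_conj]
  ring

theorem memLp_fockKernel (hα : ∀ l, α l ≠ 0) (w : Fin m → ℂ) :
    MemLp (fockKernel α w) 2 (fockMeasure α) := by
  refine memLp_fockMeasure_of_norm_le hα (differentiable_fockKernel w).continuous (D := 1)
    (θ := 0) (b := fun l => Real.pi * ‖α l‖ * ‖α l * w l‖) (fun _ => zero_lt_one) fun z => ?_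
  rw [fockKernel, Complex.norm_exp, one_mul]
  refine Real.exp_le_exp.2 ((re_fockPairing_le z w).trans (le_of_eq ?_))
  simp

theorem isFiniteMeasure_fockMeasure (hα : ∀ l, α l ≠ 0) : IsFiniteMeasure (fockMeasure α) := by
  have h : MemLp (fun _ => (1 : ℂ)) 2 (fockMeasure α) :=
    memLp_fockMeasure_of_norm_le hα continuous_const (D := 1) (θ := 0) (b := 0)
      (fun _ => zero_lt_one) fun z => by simp
  rw [memLp_const_iff two_ne_zero ENNReal.ofNat_ne_top] at h
  exact ⟨h.resolve_left one_ne_zero⟩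

theorem fockMeasure_real_univ_pos (hα : ∀ l, α l ≠ 0) : 0 < (fockMeasure α).real Set.univ := by
  have := isFiniteMeasure_fockMeasure hα
  have hac : (volume : Measure (Fin m → ℂ)) ≪ fockMeasure α := by
    refine withDensity_absolutelyContinuous'
      (ENNReal.continuous_ofReal.comp (by fun_prop)).aemeasurable (Filter.Eventually.of_forall ?_)
    intro z
    simp [Real.exp_pos]
  refine ENNReal.toReal_pos (fun h => ?_) (measure_ne_top _ _)
  exact (NeZero.ne (volume : Measure (Fin m → ℂ))) (Measure.measure_univ_eq_zero.1 (hac h))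

theorem fockMeasure_one_real_univ : (fockMeasure (1 : Fin m → ℂ)).real Set.univ = 1 := by
  have h := integral_fockMeasure (α := (1 : Fin m → ℂ)) fun _ => 1
  rw [integral_const] at h
  have h2 : ∀ z : Fin m → ℂ, Complex.exp (-fockPairing 1 z z) * 1 =
      ∏ l, Complex.exp (-(Real.pi : ℂ) * (‖z l‖ : ℂ) ^ 2) := fun z => by
    rw [fockPairing_self, ← Complex.exp_sum, mul_one, ← Finset.mul_sum]
    push_cast
    simp
  simp_rw [h2] at h
  rw [integral_fintype_prod_volume_eq_pow fun z : ℂ => Complex.exp (-(Real.pi : ℂ) * (‖z‖ : ℂ) ^ 2),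
    GaussianFourier.integral_cexp_neg_mul_sq_norm (by simp [Real.pi_pos]),
    div_self (by simp [Real.pi_ne_zero])] at h
  simpa using h

theorem measurePreserving_rotation (θ : ℝ) :
    MeasurePreserving (fun z : Fin m → ℂ => Complex.exp (θ * Complex.I) • z) (fockMeasure α)
      (fockMeasure α) := by
  have h0 : MeasurePreserving (fun z : ℂ => Complex.exp (θ * Complex.I) * z) :=
    (rotation (Circle.exp θ)).measurePreserving
  have h1 : MeasurePreserving (fun z : Fin m → ℂ => Complex.exp (θ * Complex.I) • z) :=
    volume_preserving_pi fun _ => h0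
  refine ⟨h1.measurable, Measure.ext fun s hs => ?_⟩
  rw [Measure.map_apply h1.measurable hs, fockMeasure,
    withDensity_apply _ (h1.measurable hs), withDensity_apply _ hs,
    ← h1.setLIntegral_comp_preimage hs (by
      exact (ENNReal.continuous_ofReal.comp (by fun_prop)).measurable)]
  refine lintegral_congr fun z => ?_
  congr 5
  ext l
  simp only [Pi.smul_apply, smul_eq_mul, norm_mul, Complex.norm_exp_ofReal_mul_I, one_mul]

/-- The mean value property with respect to the rotation invariant Gaussian weight. -/
theorem integral_fockMeasure_eq_mul_apply_zero (hα : ∀ l, α l ≠ 0) {F : (Fin m → ℂ) → ℂ}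
    (hF : Differentiable ℂ F) (hi : Integrable F (fockMeasure α)) :
    ∫ z, F z ∂fockMeasure α = (fockMeasure α).real Set.univ * F 0 := by
  have := isFiniteMeasure_fockMeasure hα
  set Φ : ℝ → (Fin m → ℂ) → ℂ := fun θ z => F (Complex.exp (θ * Complex.I) • z)
  have hΦc : Continuous (Function.uncurry Φ) := by
    have := hF.continuous
    simp only [Φ, Function.uncurry_def]
    fun_prop
  have hemb : ∀ θ : ℝ, ∀ {E : Type} [NormedAddCommGroup E] [NormedSpace ℝ E]
      {G : (Fin m → ℂ) → E}, Continuous G →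
      ∫ z, G (Complex.exp (θ * Complex.I) • z) ∂fockMeasure α = ∫ z, G z ∂fockMeasure α := by
    intro θ E _ _ G hG
    have h := measurePreserving_rotation (α := α) θ
    conv_rhs => rw [← h.map_eq]
    rw [integral_map h.measurable.aemeasurable]
    rw [h.map_eq]
    exact hG.aestronglyMeasurable
  have hint : Integrable (Function.uncurry Φ)
      ((volume.restrict (Set.Ioc 0 (2 * Real.pi))).prod (fockMeasure α)) := by
    rw [integrable_prod_iff hΦc.aestronglyMeasurable]
    refine ⟨Filter.Eventually.of_forall fun θ => ?_, ?_⟩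
    · exact ((measurePreserving_rotation (α := α) θ).integrable_comp
        hF.continuous.aestronglyMeasurable).2 hi
    · have : (fun θ : ℝ => ∫ z, ‖Function.uncurry Φ (θ, z)‖ ∂fockMeasure α) =
          fun _ => ∫ z, ‖F z‖ ∂fockMeasure α := by
        ext θ
        exact hemb θ hF.continuous.norm
      rw [this]
      exact integrable_const _
  -- The one-variable mean value property on the complex line through `z`: the average of `ζ ↦ F (ζ
  -- z)` over the unit circle is `F 0`.
  have hmean : ∀ z, ∫ θ in Set.Ioc 0 (2 * Real.pi), Φ θ z = 2 * Real.pi * F 0 := by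
    intro z
    have hd : Differentiable ℂ fun ζ : ℂ => F (ζ • z) := by fun_prop
    have h := (hd.diffContOnCl (s := Metric.ball 0 |1|)).circleAverage
    rw [Real.circleAverage, intervalIntegral.integral_of_le Real.two_pi_pos.le] at h
    simp only [circleMap_zero, Complex.ofReal_one, one_mul, zero_smul] at h
    rw [inv_smul_eq_iff₀ Real.two_pi_pos.ne'] at h
    simpa using h
  have hsw := integral_integral_swap hint
  simp only [hmean] at hsw
  have hc : ∀ θ : ℝ, ∫ z, Φ θ z ∂fockMeasure α = ∫ z, F z ∂fockMeasure α :=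
    fun θ => hemb θ hF.continuous
  simp only [hc, integral_const, Complex.real_smul] at hsw
  simp only [measureReal_restrict_apply_univ, Real.volume_real_Ioc_of_le Real.two_pi_pos.le,
    sub_zero] at hsw
  have h2 : ((2 * Real.pi : ℝ) : ℂ) ≠ 0 := by exact_mod_cast Real.two_pi_pos.ne'
  refine mul_left_cancel₀ h2 ?_
  rw [hsw]; push_cast; ring

theorem fockPairing_add_left (z z' w : Fin m → ℂ) :
    fockPairing α (z + z') w = fockPairing α z w + fockPairing α z' w := by
  simp only [fockPairing, Pi.add_apply, mul_add, add_mul, Finset.sum_add_distrib]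

theorem fockPairing_add_right (z w w' : Fin m → ℂ) :
    fockPairing α z (w + w') = fockPairing α z w + fockPairing α z w' := by
  simp only [fockPairing, Pi.add_apply, mul_add, map_add, Finset.sum_add_distrib]

/-- The reproducing property. -/
theorem integral_mul_conj_fockKernel (hα : ∀ l, α l ≠ 0) {F : (Fin m → ℂ) → ℂ}
    (hF : Differentiable ℂ F) (hF2 : MemLp F 2 (fockMeasure α)) (w : Fin m → ℂ) :
    ∫ z, F z * starRingEnd ℂ (fockKernel α w z) ∂fockMeasure α =
      (fockMeasure α).real Set.univ * F w := by
  have hi : Integrable (fun z => F z * starRingEnd ℂ (fockKernel α w z)) (fockMeasure α) :=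
    hF2.integrable_mul (memLp_fockKernel hα w).star
  -- Translating by `w` merges the weight and the conjugate kernel into the weight at `z` times `exp
  -- (-fockPairing α z w)`. This factor is holomorphic in `z`, so the mean value property applies to
  -- `G`, whose value at `0` is `F w`.
  set G : (Fin m → ℂ) → ℂ := fun z => F (z + w) * Complex.exp (-fockPairing α z w) with hG
  have hshift : ∀ z, Complex.exp (-fockPairing α (z + w) (z + w)) *
      (F (z + w) * starRingEnd ℂ (fockKernel α w (z + w))) =
      Complex.exp (-fockPairing α z z) * G z := by
    intro z
    rw [conj_fockKernel, fockKernel, hG]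
    dsimp only
    rw [mul_left_comm, ← Complex.exp_add, mul_left_comm, ← Complex.exp_add]
    congr 2
    simp only [fockPairing_add_left, fockPairing_add_right]
    ring
  have hGd : Differentiable ℂ G := by
    have : Differentiable ℂ fun z => fockPairing α z w := by
      unfold fockPairing; fun_prop
    fun_prop
  have hGi : Integrable G (fockMeasure α) := by
    rw [integrable_fockMeasure_iff'] at hi ⊢
    refine (hi.comp_add_right w).congr (Filter.Eventually.of_forall hshift)
  have h0 := integral_fockMeasure_eq_mul_apply_zero hα hGd hGi
  have hG0 : G 0 = F w := by simp [hG, fockPairing]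
  rw [integral_fockMeasure, ← integral_add_right_eq_self _ w, ← hG0, ← h0, integral_fockMeasure]
  exact integral_congr_ae (Filter.Eventually.of_forall hshift)

namespace Fock

/-- A square integrable entire function as an element of the Fock space. -/
def mk (F : (Fin m → ℂ) → ℂ) (hF : Differentiable ℂ F) (hF2 : MemLp F 2 (fockMeasure α)) :
    Fock α := ⟨F, hF, hF2⟩

@[simp]
theorem fn_mk (F : (Fin m → ℂ) → ℂ) (hF : Differentiable ℂ F) (hF2 : MemLp F 2 (fockMeasure α)) :
    fn α (mk F hF hF2) = F := rfl

theorem norm_def (F : Fock α) : ‖F‖ = ‖toL2 α F‖ := rfl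

/-- The reproducing kernel at `w` as an element of the Fock space. -/
def kernel (hα : ∀ l, α l ≠ 0) (w : Fin m → ℂ) : Fock α :=
  mk (fockKernel α w) (differentiable_fockKernel w) (memLp_fockKernel hα w)

theorem inner_toL2 (F G : Fock α) :
    inner ℂ (toL2 α F) (toL2 α G) = ∫ z, fn α G z * starRingEnd ℂ (fn α F z) ∂fockMeasure α := by
  rw [L2.inner_def]
  refine integral_congr_ae ?_
  filter_upwards [F.memLp.coeFn_toLp, G.memLp.coeFn_toLp] with z h1 h2
  change inner ℂ ((F.memLp.toLp _ : Lp ℂ 2 (fockMeasure α)) z)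
    ((G.memLp.toLp _ : Lp ℂ 2 (fockMeasure α)) z) = _
  rw [h1, h2]
  simp [mul_comm]

theorem inner_kernel (hα : ∀ l, α l ≠ 0) (w : Fin m → ℂ) (F : Fock α) :
    inner ℂ (toL2 α (kernel hα w)) (toL2 α F) = (fockMeasure α).real Set.univ * fn α F w := by
  rw [inner_toL2]
  exact integral_mul_conj_fockKernel hα F.differentiable F.memLp w

/-- Cauchy–Schwarz against the reproducing kernel at `w`, whose squared norm is the total mass of
the weight times its own value at `w`. -/
theorem exists_norm_apply_le (hα : ∀ l, α l ≠ 0) (F : Fock α) :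
    ∃ K, 0 ≤ K ∧ ∀ w, ‖fn α F w‖ ≤ K * Real.exp (Real.pi / 2 * ∑ l, ‖α l * w l‖ ^ 2) := by
  set C := (fockMeasure α).real Set.univ
  have hC : 0 < C := fockMeasure_real_univ_pos hα
  refine ⟨‖F‖ * √C / C, by positivity, fun w => ?_⟩
  have h1 : ‖kernel hα w‖ = √C * Real.exp (Real.pi / 2 * ∑ l, ‖α l * w l‖ ^ 2) := by
    have h2 := inner_kernel hα w (kernel hα w)
    rw [inner_self_eq_norm_sq_to_K, ← norm_def] at h2
    have h3 : fn α (kernel hα w) w = ((Real.exp (Real.pi * ∑ l, ‖α l * w l‖ ^ 2) : ℝ) : ℂ) := by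
      rw [kernel, fn_mk, fockKernel, fockPairing_self, Complex.ofReal_exp]
    rw [h3] at h2
    have h4 : ‖kernel hα w‖ ^ 2 = C * Real.exp (Real.pi * ∑ l, ‖α l * w l‖ ^ 2) := by
      refine Complex.ofReal_injective ?_
      rw [Complex.ofReal_pow, Complex.ofReal_mul]
      exact h2
    rw [← Real.sqrt_sq (norm_nonneg (kernel hα w)), h4, Real.sqrt_mul hC.le]
    congr 1
    rw [Real.sqrt_eq_iff_mul_self_eq (Real.exp_pos _).le (Real.exp_pos _).le, ← Real.exp_add]
    congr 1; ring
  have h5 : C * ‖fn α F w‖ ≤ ‖kernel hα w‖ * ‖F‖ := by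
    have := norm_inner_le_norm (𝕜 := ℂ) (toL2 α (kernel hα w)) (toL2 α F)
    rw [inner_kernel, norm_mul, Complex.norm_real, Real.norm_of_nonneg hC.le] at this
    exact this
  rw [h1] at h5
  rw [div_mul_eq_mul_div, le_div_iff₀ hC]
  linarith

end Fock
end

noncomputable section

/-! ### Bargmann kernel and coherent states -/

variable {m : ℕ}

/-- The integral kernel `exp (t·ξ - ξ²/4 - t²/2)` of the Bargmann transform. -/
def bargmannKernel (t : Fin m → ℂ) (ξ : Fin m → ℝ) : ℂ :=
  Complex.exp (∑ l, (t l * ξ l - (ξ l : ℂ) ^ 2 / 4 - t l ^ 2 / 2))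

theorem continuous_bargmannKernel (t : Fin m → ℂ) : Continuous (bargmannKernel t) := by
  unfold bargmannKernel; fun_prop

theorem norm_bargmannKernel_le (t : Fin m → ℂ) (ξ : Fin m → ℝ) :
    ‖bargmannKernel t ξ‖ ≤
      Real.exp (∑ l, ‖t l‖ ^ 2 / 2) * Real.exp (∑ l, (-(1 / 4) * ‖ξ l‖ ^ 2 + ‖t l‖ * ‖ξ l‖)) := by
  rw [bargmannKernel, Complex.norm_exp, ← Real.exp_add, ← Finset.sum_add_distrib, Complex.re_sum]
  refine Real.exp_le_exp.2 (Finset.sum_le_sum fun l _ => ?_)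
  have h1 : (t l * ξ l).re ≤ ‖t l‖ * ‖ξ l‖ := by
    simpa using Complex.re_le_norm (t l * ξ l)
  have h2 : -(t l ^ 2).re ≤ ‖t l‖ ^ 2 := by
    have := Complex.re_le_norm (-(t l ^ 2))
    rwa [norm_neg, norm_pow, Complex.neg_re] at this
  have h3 : ((ξ l : ℂ) ^ 2 / 4).re = ‖ξ l‖ ^ 2 / 4 := by
    rw [Real.norm_eq_abs, sq_abs, ← Complex.ofReal_re (ξ l ^ 2 / 4)]; push_cast; rfl
  have h4 : (t l ^ 2 / 2).re = (t l ^ 2).re / 2 := by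
    rw [show (2 : ℂ) = ((2 : ℝ) : ℂ) by norm_num, Complex.div_ofReal_re]
  rw [Complex.sub_re, Complex.sub_re, h3, h4]
  linarith

theorem memLp_exp_sum_neg_sq_add {a : Fin m → ℝ} (ha : ∀ l, 0 < a l) (b : Fin m → ℝ) :
    MemLp (fun ξ : Fin m → ℝ => Real.exp (∑ l, (-a l * ‖ξ l‖ ^ 2 + b l * ‖ξ l‖))) 2 := by
  have hc : Continuous fun ξ : Fin m → ℝ =>
      Real.exp (∑ l, (-a l * ‖ξ l‖ ^ 2 + b l * ‖ξ l‖)) := by fun_prop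
  rw [memLp_two_iff_integrable_sq_norm hc.aestronglyMeasurable]
  refine (integrable_exp_sum_neg_sq_add (V := ℝ) (a := fun l => 2 * a l) (fun l => by
    have := ha l; positivity) fun l => 2 * b l).congr (Filter.Eventually.of_forall fun ξ => ?_)
  dsimp only
  rw [Real.norm_eq_abs, Real.abs_exp, ← Real.exp_nat_mul, Finset.mul_sum]
  congr 1
  refine Finset.sum_congr rfl fun l _ => ?_
  push_cast; ring

theorem memLp_bargmannKernel (t : Fin m → ℂ) : MemLp (bargmannKernel t) 2 :=
  MemLp.of_le_mul (memLp_exp_sum_neg_sq_add (a := fun _ => 1 / 4) (fun _ => by norm_num) _)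
    (continuous_bargmannKernel t).aestronglyMeasurable
    (Filter.Eventually.of_forall fun ξ => (norm_bargmannKernel_le t ξ).trans (le_of_eq (by
      rw [Real.norm_eq_abs (Real.exp _), Real.abs_exp])))

/-- A Gaussian integral: completing the square cancels `t²` and the conjugate of `u²` against the
normalisation in the kernels, leaving only the mixed term. This is the reproducing kernel, and the
source of the unitarity. -/
theorem integral_bargmannKernel_mul_conj (t u : Fin m → ℂ) :
    ∫ ξ, bargmannKernel t ξ * starRingEnd ℂ (bargmannKernel u ξ) =
      ((2 * Real.pi : ℝ) : ℂ) ^ ((m : ℂ) / 2) *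
        Complex.exp (∑ l, t l * starRingEnd ℂ (u l)) := by
  have h1 : ∀ ξ : Fin m → ℝ, bargmannKernel t ξ * starRingEnd ℂ (bargmannKernel u ξ) =
      Complex.exp (-∑ l, (t l ^ 2 + starRingEnd ℂ (u l) ^ 2) / 2) *
      Complex.exp (-∑ l, (1 / 2 : ℂ) * (ξ l : ℂ) ^ 2 +
        ∑ l, (t l + starRingEnd ℂ (u l)) * ξ l) := by
    intro ξ
    simp only [bargmannKernel]
    rw [← Complex.exp_conj, ← Complex.exp_add, ← Complex.exp_add, map_sum,
      ← Finset.sum_add_distrib, ← Finset.sum_neg_distrib, ← Finset.sum_neg_distrib,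
      ← Finset.sum_add_distrib, ← Finset.sum_add_distrib]
    congr 1
    refine Finset.sum_congr rfl fun l _ => ?_
    simp only [map_sub, map_mul, map_div₀, map_pow, Complex.conj_ofReal, map_ofNat]
    ring
  simp_rw [h1]
  rw [integral_const_mul, GaussianFourier.integral_cexp_neg_sum_mul_add (by simp),
    Finset.prod_mul_distrib, ← Complex.exp_sum, mul_left_comm, ← Complex.exp_add]
  congr 1
  · rw [Finset.prod_const, Finset.card_univ, Fintype.card_fin, ← Complex.cpow_nat_mul]
    congr 1
    · push_cast; ring
    · ring
  · rw [← Finset.sum_neg_distrib, ← Finset.sum_add_distrib]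
    congr 1
    refine Finset.sum_congr rfl fun l _ => ?_
    ring

theorem bargmannKernel_I_mul (y : Fin m → ℝ) (ξ : Fin m → ℝ) :
    bargmannKernel (fun l => Complex.I * y l) ξ =
      Complex.exp (∑ l, (y l : ℂ) ^ 2 / 2) *
        (((Real.exp (-(1 / 4) * ∑ l, ξ l ^ 2) : ℝ) : ℂ) *
          Complex.exp (Complex.I * ∑ l, (y l : ℂ) * ξ l)) := by
  rw [bargmannKernel, Complex.ofReal_exp, ← Complex.exp_add, ← Complex.exp_add]
  congr 1
  push_cast
  rw [Finset.mul_sum, Finset.mul_sum, ← Finset.sum_add_distrib, ← Finset.sum_add_distrib]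
  refine Finset.sum_congr rfl fun l _ => ?_
  rw [mul_pow, Complex.I_sq]; ring

/-- At `t = i y` the kernel is, up to a nonzero factor, `e^{-ξ²/4}` times a character, so Fourier
uniqueness applies to `e^{-ξ²/4} h`. Only this product has to be integrable; the inversion formula
uses the lemma for a function not yet known to be in `L²`. -/
theorem ae_eq_zero_of_forall_integral_bargmannKernel_eq_zero {h : (Fin m → ℝ) → ℂ}
    (hh : Integrable fun ξ => ((Real.exp (-(1 / 4) * ∑ l, ξ l ^ 2) : ℝ) : ℂ) * h ξ)
    (H : ∀ y : Fin m → ℝ, ∫ ξ, bargmannKernel (fun l => Complex.I * y l) ξ * h ξ = 0) :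
    h =ᵐ[volume] 0 := by
  have h1 := ae_eq_zero_of_forall_integral_mul_cexp_eq_zero hh fun y => by
    have h2 := H y
    simp_rw [bargmannKernel_I_mul, mul_assoc] at h2
    rw [integral_const_mul, mul_eq_zero, or_iff_right (Complex.exp_ne_zero _)] at h2
    rw [← h2]
    refine integral_congr_ae (Filter.Eventually.of_forall fun ξ => ?_)
    ring
  filter_upwards [h1] with ξ h2
  rw [Pi.zero_apply, mul_eq_zero] at h2
  exact h2.resolve_left (by exact_mod_cast (Real.exp_pos _).ne')

/-- The factor `e^{-t²/2}` is split off, leaving an exponential linear in `t`; differentiation under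
the integral is allowed because `e^{-ξ²/4} g` absorbs every exponential of `∑ |ξ_l|`. -/
theorem differentiable_integral_bargmannKernel_mul {g : (Fin m → ℝ) → ℂ} (hg : MemLp g 2) :
    Differentiable ℂ fun t => ∫ ξ, bargmannKernel t ξ * g ξ := by
  set φ : (Fin m → ℝ) → ((Fin m → ℂ) →L[ℂ] ℂ) := fun ξ =>
    ∑ l, (ξ l : ℂ) • ContinuousLinearMap.proj (R := ℂ) (φ := fun _ : Fin m => ℂ) l
  have hφa : ∀ ξ t, φ ξ t = ∑ l, t l * (ξ l : ℂ) := fun ξ t => by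
    simp [φ, mul_comm]
  have hφn : ∀ ξ, ‖φ ξ‖ ≤ Real.exp (∑ l, ‖ξ l‖) := fun ξ => by
    refine le_trans (ContinuousLinearMap.opNorm_le_bound _
      (Finset.sum_nonneg fun l _ => norm_nonneg (ξ l)) fun t => ?_)
      ((le_add_of_nonneg_right zero_le_one).trans (Real.add_one_le_exp _))
    rw [hφa, Finset.sum_mul]
    refine norm_sum_le_of_le _ fun l _ => ?_
    rw [norm_mul, Complex.norm_real, mul_comm]
    gcongr
    exact norm_le_pi_norm t l
  set ψ : (Fin m → ℝ) → ℂ := fun ξ => ((Real.exp (-(1 / 4) * ∑ l, ξ l ^ 2) : ℝ) : ℂ) * g ξ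
  have hsplit : (fun t => ∫ ξ, bargmannKernel t ξ * g ξ) = fun t : Fin m → ℂ =>
      Complex.exp (-∑ l, t l ^ 2 / 2) * ∫ ξ, Complex.exp (φ ξ t) * ψ ξ := by
    ext t
    rw [← integral_const_mul]
    refine integral_congr_ae (Filter.Eventually.of_forall fun ξ => ?_)
    simp only [ψ]
    rw [← mul_assoc, ← mul_assoc, Complex.ofReal_exp, ← Complex.exp_add, ← Complex.exp_add, hφa,
      bargmannKernel]
    congr 2
    push_cast
    rw [Finset.mul_sum, ← Finset.sum_neg_distrib, ← Finset.sum_add_distrib,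
      ← Finset.sum_add_distrib]
    refine Finset.sum_congr rfl fun l _ => ?_
    ring
  have hψm : AEStronglyMeasurable ψ := by
    have : Continuous fun ξ : Fin m → ℝ => ((Real.exp (-(1 / 4) * ∑ l, ξ l ^ 2) : ℝ) : ℂ) := by
      fun_prop
    exact this.aestronglyMeasurable.mul hg.1
  have hbound : ∀ R : ℝ, Integrable fun ξ => Real.exp (R * ∑ l, ‖ξ l‖) * ‖ψ ξ‖ := fun R => by
    have h1 : MemLp (fun ξ : Fin m → ℝ =>
        Real.exp (∑ l, (-(1 / 4) * ‖ξ l‖ ^ 2 + R * ‖ξ l‖))) 2 :=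
      memLp_exp_sum_neg_sq_add (fun _ => by norm_num) _
    refine (h1.integrable_mul hg.norm).congr (Filter.Eventually.of_forall fun ξ => ?_)
    simp only [ψ, Pi.mul_apply]
    rw [norm_mul, ← mul_assoc, Complex.norm_real, Real.norm_eq_abs (Real.exp _), Real.abs_exp,
      ← Real.exp_add]
    congr 2
    rw [Finset.mul_sum, Finset.mul_sum, ← Finset.sum_add_distrib]
    refine Finset.sum_congr rfl fun l _ => ?_
    rw [Real.norm_eq_abs, sq_abs]; ring
  have hφc : Continuous φ := by fun_prop
  have hexp : ∀ R : ℝ, ∀ t : Fin m → ℂ, ‖t‖ ≤ R → ∀ ξ,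
      ‖Complex.exp (φ ξ t) * ψ ξ‖ ≤ Real.exp (R * ∑ l, ‖ξ l‖) * ‖ψ ξ‖ := by
    intro R t ht ξ
    rw [norm_mul, Complex.norm_exp]
    gcongr
    refine (Complex.re_le_norm _).trans ?_
    rw [hφa, Finset.mul_sum]
    refine norm_sum_le_of_le _ fun l _ => ?_
    rw [norm_mul, Complex.norm_real]
    gcongr
    exact (norm_le_pi_norm t l).trans ht
  have hmeas : ∀ t, AEStronglyMeasurable fun ξ => Complex.exp (φ ξ t) * ψ ξ := fun t =>
    (Continuous.aestronglyMeasurable (by fun_prop)).mul hψm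
  rw [hsplit]
  refine Differentiable.mul (by fun_prop) fun t => ?_
  have hd := hasFDerivAt_integral_of_dominated_of_fderiv_le (μ := (volume : Measure (Fin m → ℝ)))
    (𝕜 := ℂ) (F := fun t ξ => Complex.exp (φ ξ t) * ψ ξ) (x₀ := t) (s := Metric.ball t 1)
    (F' := fun t ξ => (Complex.exp (φ ξ t) * ψ ξ) • φ ξ)
    -- One unit pays for the radius of the ball around `t`, the other for the factor `‖φ ξ‖ ≤ exp (∑
    -- |ξ_l|)` produced by the derivative.
    (bound := fun ξ => Real.exp ((‖t‖ + 1 + 1) * ∑ l, ‖ξ l‖) * ‖ψ ξ‖)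
    (Metric.ball_mem_nhds t one_pos) (Filter.Eventually.of_forall hmeas)
    ((hbound ‖t‖).mono' (hmeas t) (Filter.Eventually.of_forall (hexp _ t le_rfl)))
    ((hmeas t).smul hφc.aestronglyMeasurable)
    (Filter.Eventually.of_forall fun ξ u hu => ?_) (hbound _)
    (Filter.Eventually.of_forall fun ξ u _ => ?_)
  · exact hd.differentiableAt
  · have hu' : ‖u‖ ≤ ‖t‖ + 1 := by
      have := norm_le_norm_add_norm_sub' u t
      rw [mem_ball_iff_norm] at hu
      linarith
    rw [norm_smul, add_mul _ 1, one_mul, Real.exp_add, mul_right_comm]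
    exact mul_le_mul (hexp _ u hu' ξ) (hφn ξ) (norm_nonneg _) (by positivity)
  · have h1 := ((φ ξ).hasFDerivAt (x := u)).cexp.mul_const (ψ ξ)
    have h2 : (Complex.exp (φ ξ u) * ψ ξ) • φ ξ = ψ ξ • Complex.exp (φ ξ u) • φ ξ := by
      rw [smul_smul, mul_comm]
    rw [h2]
    exact h1

/-- The complex conjugate of `bargmannKernel t` as a vector of `L²`. -/
def coherentState (t : Fin m → ℂ) : KacBaker.L2 m :=
  (memLp_bargmannKernel t).star.toLp

theorem coeFn_coherentState (t : Fin m → ℂ) :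
    coherentState t =ᵐ[volume] fun ξ => starRingEnd ℂ (bargmannKernel t ξ) :=
  MemLp.coeFn_toLp _

theorem inner_coherentState (t : Fin m → ℂ) (g : KacBaker.L2 m) :
    inner ℂ (coherentState t) g = ∫ ξ, bargmannKernel t ξ * g ξ := by
  rw [L2.inner_def]
  refine integral_congr_ae ?_
  filter_upwards [coeFn_coherentState t] with ξ h
  simp [h, mul_comm]

theorem integrable_bargmannKernel_mul (t : Fin m → ℂ) (g : KacBaker.L2 m) :
    Integrable fun ξ => bargmannKernel t ξ * g ξ :=
  (memLp_bargmannKernel t).integrable_mul (Lp.memLp g)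

/-- A vector orthogonal to all coherent states is orthogonal to those with `t = i y`, and these
already force it to vanish. -/
theorem span_coherentState_dense :
    (Submodule.span ℂ (Set.range (coherentState (m := m)))).topologicalClosure = ⊤ := by
  rw [Submodule.topologicalClosure_eq_top_iff, Submodule.eq_bot_iff]
  intro g hg
  rw [Submodule.mem_orthogonal] at hg
  refine Lp.ext ?_
  have h0 := ae_eq_zero_of_forall_integral_bargmannKernel_eq_zero (h := g) ?_ fun y => ?_
  · exact h0.trans (Lp.coeFn_zero _ _ _).symm
  · refine (integrable_bargmannKernel_mul 0 g).congr (Filter.Eventually.of_forall fun ξ => ?_)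
    dsimp only
    rw [bargmannKernel, Complex.ofReal_exp]
    congr 2
    push_cast
    rw [Finset.mul_sum]
    refine Finset.sum_congr rfl fun l _ => ?_
    simp; ring
  · rw [← inner_coherentState]
    exact hg _ (Submodule.subset_span ⟨_, rfl⟩)

/-- The normalising constant `(2π)^{-m/4}` of the Bargmann transform. -/
def bargmannConst (m : ℕ) : ℝ := (1 / (2 * Real.pi)) ^ ((m : ℝ) / 4)

theorem two_pi_cpow_eq_ofReal :
    ((2 * Real.pi : ℝ) : ℂ) ^ ((m : ℂ) / 2) = (((2 * Real.pi) ^ ((m : ℝ) / 2) : ℝ) : ℂ) := by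
  rw [Complex.ofReal_cpow Real.two_pi_pos.le]; push_cast; rfl

theorem conj_two_pi_cpow :
    starRingEnd ℂ (((2 * Real.pi : ℝ) : ℂ) ^ ((m : ℂ) / 2)) =
      ((2 * Real.pi : ℝ) : ℂ) ^ ((m : ℂ) / 2) := by
  rw [two_pi_cpow_eq_ofReal, Complex.conj_ofReal]

theorem two_pi_cpow_mul_bargmannConst_sq :
    ((2 * Real.pi : ℝ) : ℂ) ^ ((m : ℂ) / 2) * (bargmannConst m * bargmannConst m) = 1 := by
  rw [two_pi_cpow_eq_ofReal, ← Complex.ofReal_mul, ← Complex.ofReal_mul, bargmannConst,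
    ← Real.rpow_add (by positivity), one_div, Real.inv_rpow Real.two_pi_pos.le,
    show (m : ℝ) / 4 + m / 4 = m / 2 by ring, mul_inv_cancel₀ (by positivity), Complex.ofReal_one]

/-- The Bargmann transform with scale `s`, a function of `z` through `s z`. -/
def bargmann (s : Fin m → ℂ) (g : KacBaker.L2 m) (z : Fin m → ℂ) : ℂ :=
  bargmannConst m * ∫ ξ, bargmannKernel (fun l => s l * z l) ξ * g ξ

theorem bargmann_eq_inner (s : Fin m → ℂ) (g : KacBaker.L2 m) (z : Fin m → ℂ) :
    bargmann s g z = bargmannConst m * inner ℂ (coherentState fun l => s l * z l) g := by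
  rw [inner_coherentState, bargmann]

theorem differentiable_bargmann (s : Fin m → ℂ) (g : KacBaker.L2 m) :
    Differentiable ℂ (bargmann s g) := by
  have h := differentiable_integral_bargmannKernel_mul (Lp.memLp g)
  have h2 : Differentiable ℂ fun z : Fin m → ℂ => fun l => s l * z l := by fun_prop
  exact (h.comp h2).const_mul _

theorem bargmann_add (s : Fin m → ℂ) (g h : KacBaker.L2 m) :
    bargmann s (g + h) = bargmann s g + bargmann s h := by
  ext z
  simp only [bargmann_eq_inner, Pi.add_apply, inner_add_right, mul_add]

theorem bargmann_smul (s : Fin m → ℂ) (c : ℂ) (g : KacBaker.L2 m) :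
    bargmann s (c • g) = c • bargmann s g := by
  ext z
  simp only [bargmann_eq_inner, Pi.smul_apply, inner_smul_right, smul_eq_mul]
  ring

/-! ### The Bargmann transform is an isomorphism onto the Fock space -/

section Unitarity

variable {s α : Fin m → ℂ}

theorem fockKernel_eq (hsα : ∀ l, α l = s l / √Real.pi) (w z : Fin m → ℂ) :
    fockKernel α w z = Complex.exp (∑ l, s l * z l * starRingEnd ℂ (s l * w l)) := by
  rw [fockKernel, fockPairing, Finset.mul_sum]
  congr 1
  refine Finset.sum_congr rfl fun l _ => ?_
  have h : (√Real.pi : ℂ) ^ 2 = Real.pi := by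
    rw [← Complex.ofReal_pow, Real.sq_sqrt Real.pi_pos.le]
  have h0 : (√Real.pi : ℂ) ≠ 0 := by
    exact_mod_cast (Real.sqrt_pos.2 Real.pi_pos).ne'
  simp only [hsα, map_mul, map_div₀, Complex.conj_ofReal]
  rw [← h]
  field_simp

theorem bargmann_coherentState (hsα : ∀ l, α l = s l / √Real.pi) (w : Fin m → ℂ) :
    bargmann s (coherentState fun l => s l * w l) =
      (bargmannConst m * ((2 * Real.pi : ℝ) : ℂ) ^ ((m : ℂ) / 2)) • fockKernel α w := by
  ext z
  rw [Pi.smul_apply, fockKernel_eq hsα, smul_eq_mul, mul_assoc, ← integral_bargmannKernel_mul_conj,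
    bargmann]
  congr 1
  refine integral_congr_ae ?_
  filter_upwards [coeFn_coherentState fun l => s l * w l] with ξ h
  rw [h]

/-- On a coherent state the transform is a multiple of a reproducing kernel, so the pairing is an
evaluation of `bargmann s g`, that is, an inner product with that coherent state. Linearity extends
this to the span; `g = h` gives the norm identity there. -/
theorem bargmann_of_mem_span (hsα : ∀ l, α l = s l / √Real.pi) (hs : ∀ l, s l ≠ 0)
    {h : KacBaker.L2 m} (hh : h ∈ Submodule.span ℂ (Set.range (coherentState (m := m)))) :
    MemLp (bargmann s h) 2 (fockMeasure α) ∧ ∀ g : KacBaker.L2 m,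
      MemLp (bargmann s g) 2 (fockMeasure α) →
      ∫ z, bargmann s g z * starRingEnd ℂ (bargmann s h z) ∂fockMeasure α =
        (fockMeasure α).real Set.univ * inner ℂ h g := by
  have hα : ∀ l, α l ≠ 0 := fun l => by
    rw [hsα]
    exact div_ne_zero (hs l) (by exact_mod_cast (Real.sqrt_pos.2 Real.pi_pos).ne')
  induction hh using Submodule.span_induction with
  | mem h hh =>
    obtain ⟨t, rfl⟩ := hh
    have ht : t = fun l => s l * (t l / s l) := funext fun l => by
      have := hs l; field_simp
    set w : Fin m → ℂ := fun l => t l / s l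
    rw [ht, bargmann_coherentState hsα]
    refine ⟨(memLp_fockKernel hα w).const_smul _, fun g hg => ?_⟩
    simp only [Pi.smul_apply, smul_eq_mul, map_mul, mul_left_comm (bargmann s g _)]
    rw [integral_const_mul, integral_mul_conj_fockKernel hα (differentiable_bargmann s g) hg,
      bargmann_eq_inner, Complex.conj_ofReal]
    rw [conj_two_pi_cpow]
    linear_combination ((fockMeasure α).real Set.univ : ℂ) *
      inner ℂ (coherentState fun l => s l * w l) g * two_pi_cpow_mul_bargmannConst_sq (m := m)
  | zero =>
    have h0 : bargmann s (0 : KacBaker.L2 m) = 0 := by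
      ext z; simp [bargmann_eq_inner]
    rw [h0]
    exact ⟨MemLp.zero, fun g _ => by simp⟩
  | add x y _ _ hx hy =>
    rw [bargmann_add]
    refine ⟨hx.1.add hy.1, fun g hg => ?_⟩
    rw [inner_add_left, mul_add, ← hx.2 g hg, ← hy.2 g hg, ← integral_add]
    · simp only [Pi.add_apply, map_add, mul_add]
    · exact hg.integrable_mul hx.1.star
    · exact hg.integrable_mul hy.1.star
  | smul c x _ hx =>
    rw [bargmann_smul]
    refine ⟨hx.1.const_smul c, fun g hg => ?_⟩
    simp only [Pi.smul_apply, smul_eq_mul, map_mul, mul_left_comm (bargmann s g _)]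
    rw [integral_const_mul, hx.2 g hg, inner_smul_left]
    ring

theorem eLpNorm_bargmann_of_mem_span (hsα : ∀ l, α l = s l / √Real.pi) (hs : ∀ l, s l ≠ 0)
    {h : KacBaker.L2 m} (hh : h ∈ Submodule.span ℂ (Set.range (coherentState (m := m)))) :
    eLpNorm (bargmann s h) 2 (fockMeasure α) =
      ENNReal.ofReal (√((fockMeasure α).real Set.univ) * ‖h‖) := by
  obtain ⟨h1, h2⟩ := bargmann_of_mem_span hsα hs hh
  have h3 := h2 h h1
  set F : Fock α := Fock.mk (bargmann s h) (differentiable_bargmann s h) h1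
  have h4 := Fock.inner_toL2 F F
  rw [Fock.fn_mk, h3, inner_self_eq_norm_sq_to_K, inner_self_eq_norm_sq_to_K] at h4
  have h5 : ‖Fock.toL2 α F‖ ^ 2 = (fockMeasure α).real Set.univ * ‖h‖ ^ 2 := by
    refine Complex.ofReal_injective ?_
    rw [Complex.ofReal_pow, Complex.ofReal_mul, Complex.ofReal_pow]
    exact h4
  have h6 : ‖Fock.toL2 α F‖ = √((fockMeasure α).real Set.univ) * ‖h‖ := by
    rw [← Real.sqrt_sq (norm_nonneg (Fock.toL2 α F)), h5, Real.sqrt_mul measureReal_nonneg,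
      Real.sqrt_sq (norm_nonneg h)]
  rw [← h6, Lp.norm_def, ENNReal.ofReal_toReal (Lp.eLpNorm_ne_top _)]
  exact (eLpNorm_congr_ae F.memLp.coeFn_toLp).symm

/-- Evaluation of the transform at a point is continuous on `L²`, being an inner product with a
coherent state. So an approximating sequence from the dense span has pointwise convergent
transforms, and Fatou's lemma carries the bound over. -/
theorem eLpNorm_bargmann_le (hsα : ∀ l, α l = s l / √Real.pi) (hs : ∀ l, s l ≠ 0)
    (g : KacBaker.L2 m) :
    eLpNorm (bargmann s g) 2 (fockMeasure α) ≤
      ENNReal.ofReal (√((fockMeasure α).real Set.univ) * ‖g‖) := by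
  have hg : g ∈ closure (Submodule.span ℂ (Set.range (coherentState (m := m))) :
      Set (KacBaker.L2 m)) := by
    rw [← Submodule.topologicalClosure_coe, span_coherentState_dense]
    trivial
  obtain ⟨x, hx, hxg⟩ := mem_closure_iff_seq_limit.1 hg
  have h1 : Filter.Tendsto
      (fun n => ENNReal.ofReal (√((fockMeasure α).real Set.univ) * ‖x n‖)) Filter.atTop
      (nhds (ENNReal.ofReal (√((fockMeasure α).real Set.univ) * ‖g‖))) :=
    ENNReal.tendsto_ofReal (hxg.norm.const_mul _)
  have h2 := Lp.eLpNorm_lim_le_liminf_eLpNorm (p := 2) (μ := fockMeasure α)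
    (f := fun n => bargmann s (x n))
    (fun n => (differentiable_bargmann s (x n)).continuous.aestronglyMeasurable) (bargmann s g)
    (Filter.Eventually.of_forall fun z => by
      simp only [bargmann_eq_inner]
      exact (Filter.Tendsto.inner tendsto_const_nhds hxg).const_mul _)
  simp_rw [fun n => eLpNorm_bargmann_of_mem_span hsα hs (hx n)] at h2
  rwa [h1.liminf_eq] at h2

theorem memLp_bargmann (hsα : ∀ l, α l = s l / √Real.pi) (hs : ∀ l, s l ≠ 0)
    (g : KacBaker.L2 m) : MemLp (bargmann s g) 2 (fockMeasure α) :=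
  ⟨(differentiable_bargmann s g).continuous.aestronglyMeasurable,
    (eLpNorm_bargmann_le hsα hs g).trans_lt ENNReal.ofReal_lt_top⟩

/-- The Bargmann transform as a linear map into the Fock space. -/
def bargmannLinear (hsα : ∀ l, α l = s l / √Real.pi) (hs : ∀ l, s l ≠ 0) :
    KacBaker.L2 m →ₗ[ℂ] Fock α where
  toFun g := Fock.mk (bargmann s g) (differentiable_bargmann s g) (memLp_bargmann hsα hs g)
  map_add' g h := Fock.fn_injective α (by
    rw [map_add]; simp only [Fock.fn_mk]; exact bargmann_add s g h)
  map_smul' c g := Fock.fn_injective α (by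
    rw [map_smul]; simp only [Fock.fn_mk, RingHom.id_apply]; exact bargmann_smul s c g)

theorem fn_bargmannLinear (hsα : ∀ l, α l = s l / √Real.pi) (hs : ∀ l, s l ≠ 0)
    (g : KacBaker.L2 m) : Fock.fn α (bargmannLinear hsα hs g) = bargmann s g := rfl

theorem norm_bargmannLinear_eq_toReal (hsα : ∀ l, α l = s l / √Real.pi) (hs : ∀ l, s l ≠ 0)
    (g : KacBaker.L2 m) :
    ‖bargmannLinear hsα hs g‖ = (eLpNorm (bargmann s g) 2 (fockMeasure α)).toReal := by
  rw [Fock.norm_def, Lp.norm_def]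
  congr 1
  exact eLpNorm_congr_ae (bargmannLinear hsα hs g).memLp.coeFn_toLp

theorem norm_bargmannLinear_le (hsα : ∀ l, α l = s l / √Real.pi) (hs : ∀ l, s l ≠ 0)
    (g : KacBaker.L2 m) :
    ‖bargmannLinear hsα hs g‖ ≤ √((fockMeasure α).real Set.univ) * ‖g‖ := by
  rw [norm_bargmannLinear_eq_toReal]
  exact ENNReal.toReal_le_of_le_ofReal (by positivity) (eLpNorm_bargmann_le hsα hs g)

theorem norm_bargmannLinear (hsα : ∀ l, α l = s l / √Real.pi) (hs : ∀ l, s l ≠ 0)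
    (g : KacBaker.L2 m) :
    ‖bargmannLinear hsα hs g‖ = √((fockMeasure α).real Set.univ) * ‖g‖ := by
  have hc : Continuous (bargmannLinear hsα hs) :=
    AddMonoidHomClass.continuous_of_bound _ _ (norm_bargmannLinear_le hsα hs)
  have hcl : IsClosed {g : KacBaker.L2 m |
      ‖bargmannLinear hsα hs g‖ = √((fockMeasure α).real Set.univ) * ‖g‖} :=
    isClosed_eq hc.norm (continuous_const.mul continuous_norm)
  have hsub : (Submodule.span ℂ (Set.range (coherentState (m := m))) : Set (KacBaker.L2 m)) ⊆
      {g | ‖bargmannLinear hsα hs g‖ = √((fockMeasure α).real Set.univ) * ‖g‖} := fun h hh => by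
    rw [Set.mem_ofPred_eq, norm_bargmannLinear_eq_toReal, eLpNorm_bargmann_of_mem_span hsα hs hh,
      ENNReal.toReal_ofReal (by positivity)]
  refine hcl.closure_subset_iff.2 hsub ?_
  rw [← Submodule.topologicalClosure_coe, span_coherentState_dense]
  trivial

theorem bargmannLinear_bijective (hsα : ∀ l, α l = s l / √Real.pi) (hs : ∀ l, s l ≠ 0) :
    Function.Bijective (bargmannLinear hsα hs) := by
  have hα : ∀ l, α l ≠ 0 := fun l => by
    rw [hsα]
    exact div_ne_zero (hs l) (by exact_mod_cast (Real.sqrt_pos.2 Real.pi_pos).ne')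
  have hC := fockMeasure_real_univ_pos hα
  refine ⟨(injective_iff_map_eq_zero _).2 fun g hg => ?_, fun F => ?_⟩
  · have h := norm_bargmannLinear hsα hs g
    rw [hg, norm_zero, eq_comm, mul_eq_zero] at h
    exact norm_eq_zero.1 (h.resolve_left (Real.sqrt_pos.2 hC).ne')
  · set C := (fockMeasure α).real Set.univ
    let Ψ : KacBaker.L2 m →L[ℂ] Lp ℂ 2 (fockMeasure α) :=
      ((Fock.toL2 α).comp (bargmannLinear hsα hs)).mkContinuous (√C)
        (norm_bargmannLinear_le hsα hs)
    -- The preimage is the adjoint applied to `F`: evaluating its transform at `w` pairs `F` with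
    -- the image of a coherent state, a multiple of the reproducing kernel at `w`, and hence returns
    -- `F w`.
    refine ⟨(C : ℂ)⁻¹ • (ContinuousLinearMap.adjoint Ψ) (Fock.toL2 α F),
      Fock.fn_injective α (funext fun w => ?_)⟩
    have hΨ : Ψ (coherentState fun l => s l * w l) =
        (bargmannConst m * ((2 * Real.pi : ℝ) : ℂ) ^ ((m : ℂ) / 2)) •
          Fock.toL2 α (Fock.kernel hα w) := by
      rw [← map_smul]
      change Fock.toL2 α _ = _
      congr 1
      refine Fock.fn_injective α ?_
      rw [map_smul, fn_bargmannLinear, bargmann_coherentState hsα]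
      rfl
    rw [fn_bargmannLinear, bargmann_smul, Pi.smul_apply, bargmann_eq_inner,
      ContinuousLinearMap.adjoint_inner_right, hΨ, inner_smul_left, Fock.inner_kernel,
      map_mul, conj_two_pi_cpow, Complex.conj_ofReal, smul_eq_mul, inv_mul_eq_iff_eq_mul₀ (by
        exact_mod_cast hC.ne')]
    linear_combination (C : ℂ) * Fock.fn α F w * two_pi_cpow_mul_bargmannConst_sq (m := m)

/-- The Bargmann transform as a topological isomorphism of `L²` onto the Fock space. -/
def bargmannEquiv (hsα : ∀ l, α l = s l / √Real.pi) (hs : ∀ l, s l ≠ 0) :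
    KacBaker.L2 m ≃L[ℂ] Fock α :=
  (LinearEquiv.ofBijective (bargmannLinear hsα hs)
    (bargmannLinear_bijective hsα hs)).toContinuousLinearEquivOfBounds
    (√((fockMeasure α).real Set.univ)) (√((fockMeasure α).real Set.univ))⁻¹
    (norm_bargmannLinear_le hsα hs) (fun F => by
      have hα : ∀ l, α l ≠ 0 := fun l => by
        rw [hsα]
        exact div_ne_zero (hs l) (by exact_mod_cast (Real.sqrt_pos.2 Real.pi_pos).ne')
      have hC := Real.sqrt_pos.2 (fockMeasure_real_univ_pos hα)
      obtain ⟨g, rfl⟩ := (LinearEquiv.ofBijective (bargmannLinear hsα hs)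
        (bargmannLinear_bijective hsα hs)).surjective F
      rw [LinearEquiv.symm_apply_apply, LinearEquiv.ofBijective_apply, norm_bargmannLinear,
        inv_mul_cancel_left₀ hC.ne'])

end Unitarity
end

noncomputable section
namespace KacBaker

variable {m : ℕ}

/-! ### Elementary identities and bounds for the kernels -/

section Constants

theorem rootCoupling_sq (β : ℂ) (J : Fin m → ℝ) (l : Fin m) :
    rootCoupling β J l ^ 2 = β * J l := by
  rw [rootCoupling, Complex.sqrt, Complex.cpow_ofNat_inv_pow]

theorem rootCoupling_ne_zero {β : ℂ} (hβ : β ≠ 0) {J : Fin m → ℝ} (hJ : ∀ l, 0 < J l)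
    (l : Fin m) : rootCoupling β J l ≠ 0 := fun h => by
  have := rootCoupling_sq β J l
  rw [h, zero_pow two_ne_zero, eq_comm, mul_eq_zero] at this
  exact this.elim hβ (by exact_mod_cast (hJ l).ne')

theorem sqrtCoshRoot_mul_self (β : ℂ) (J : Fin m → ℝ) (ξ : Fin m → ℝ) :
    sqrtCoshRoot β J ξ * sqrtCoshRoot β J ξ = coshRoot β J ξ := by
  rw [← sq, sqrtCoshRoot, Complex.sqrt, Complex.cpow_ofNat_inv_pow]

theorem continuous_coshRoot (β : ℂ) (J : Fin m → ℝ) : Continuous (coshRoot β J) := by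
  unfold coshRoot
  exact Complex.continuous_cosh.comp (by fun_prop)

theorem measurable_sqrtCoshRoot (β : ℂ) (J : Fin m → ℝ) : Measurable (sqrtCoshRoot β J) :=
  (continuous_coshRoot β J).measurable.pow_const _

theorem sinh_decay {x : ℝ} (hx : 0 < x) : Real.sinh (decay x) = (1 - x ^ 2) / (2 * x) := by
  rw [decay, Real.sinh_eq, neg_neg, Real.exp_neg, Real.exp_log hx]
  field_simp

theorem tanh_half_decay {x : ℝ} (hx : 0 < x) : Real.tanh (decay x / 2) = (1 - x) / (1 + x) := by
  have h1 : Real.exp (decay x / 2) = (√x)⁻¹ := by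
    rw [decay, neg_div, Real.exp_neg, Real.exp_half, Real.exp_log hx]
  have h2 : Real.exp (-(decay x / 2)) = √x := by rw [Real.exp_neg, h1, inv_inv]
  have h3 : 0 < √x := Real.sqrt_pos.2 hx
  rw [Real.tanh_eq_sinh_div_cosh, Real.sinh_eq, Real.cosh_eq, h1, h2]
  have h4 : √x ^ 2 = x := Real.sq_sqrt hx.le
  field_simp
  rw [h4]
  ring

variable {lam : Fin m → ℝ}

theorem gaussian_eq (hlam : ∀ l, 0 < lam l ∧ lam l < 1) (ξ η : Fin m → ℝ) :
    gaussian lam ξ η = Real.exp (∑ l,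
      (-(1 / 4) * ((1 + lam l ^ 2) / (1 - lam l ^ 2)) * (ξ l ^ 2 + η l ^ 2) +
        lam l / (1 - lam l ^ 2) * (ξ l * η l))) := by
  rw [gaussian, Finset.mul_sum]
  congr 1
  refine Finset.sum_congr rfl fun l _ => ?_
  obtain ⟨h0, h1⟩ := hlam l
  rw [sinh_decay h0, tanh_half_decay h0]
  have h2 : 1 - lam l ≠ 0 := (sub_pos.2 h1).ne'
  have h3 : 1 + lam l ≠ 0 := by positivity
  have h4 : 1 - lam l ^ 2 = (1 - lam l) * (1 + lam l) := by ring
  rw [h4]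
  field_simp
  ring

theorem continuous_kernelTilde (lam : Fin m → ℝ) :
    Continuous fun p : (Fin m → ℝ) × (Fin m → ℝ) => kernelTilde lam p.1 p.2 := by
  unfold kernelTilde gaussian
  fun_prop

/-- A Gaussian in terms of which all kernels are estimated. -/
def gaussWeight (lam : Fin m → ℝ) (ξ : Fin m → ℝ) : ℝ :=
  Real.exp (∑ l, -((1 - lam l) / (1 + lam l) / 16) * ‖ξ l‖ ^ 2)

theorem gaussWeight_pos (lam ξ : Fin m → ℝ) : 0 < gaussWeight lam ξ := Real.exp_pos _

theorem gaussWeight_le_one (hlam : ∀ l, 0 < lam l ∧ lam l < 1) (ξ : Fin m → ℝ) :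
    gaussWeight lam ξ ≤ 1 := by
  rw [gaussWeight, Real.exp_le_one_iff]
  refine Finset.sum_nonpos fun l _ => ?_
  have := sub_pos.2 (hlam l).2
  have := (hlam l).1
  rw [neg_mul]
  exact neg_nonpos.2 (by positivity)

theorem continuous_gaussWeight (lam : Fin m → ℝ) : Continuous (gaussWeight lam) := by
  unfold gaussWeight; fun_prop

theorem memLp_gaussWeight (hlam : ∀ l, 0 < lam l ∧ lam l < 1) : MemLp (gaussWeight lam) 2 := by
  have h := memLp_exp_sum_neg_sq_add (a := fun l => (1 - lam l) / (1 + lam l) / 16) (fun l => by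
    have := sub_pos.2 (hlam l).2
    have := (hlam l).1
    positivity) 0
  simp only [Pi.zero_apply, zero_mul, add_zero] at h
  exact h

/-- The term with `(ξ_l - η_l)²` is dropped, and the `1/16` in `gaussWeight` is chosen so that four
copies per variable remain: one for square integrability, the other three to be spent on hyperbolic
cosines and on dividing by the weight. -/
theorem gaussian_le (hlam : ∀ l, 0 < lam l ∧ lam l < 1) (ξ η : Fin m → ℝ) :
    gaussian lam ξ η ≤ gaussWeight lam ξ ^ 4 * gaussWeight lam η ^ 4 := by
  rw [gaussian, gaussWeight, gaussWeight, ← Real.exp_nat_mul, ← Real.exp_nat_mul, ← Real.exp_add,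
    Finset.mul_sum, Finset.mul_sum, Finset.mul_sum, ← Finset.sum_add_distrib]
  refine Real.exp_le_exp.2 (Finset.sum_le_sum fun l _ => ?_)
  obtain ⟨h0, h1⟩ := hlam l
  have h2 : 0 ≤ (ξ l - η l) ^ 2 / Real.sinh (decay (lam l)) := by
    rw [sinh_decay h0]
    have : 0 < 1 - lam l ^ 2 := by nlinarith
    positivity
  rw [tanh_half_decay h0, Real.norm_eq_abs, Real.norm_eq_abs, sq_abs, sq_abs]
  push_cast
  linarith

theorem kernelTilde_nonneg (lam ξ η : Fin m → ℝ) : 0 ≤ kernelTilde lam ξ η :=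
  mul_nonneg (mul_nonneg zero_le_two (Finset.prod_nonneg fun _ _ => Real.sqrt_nonneg _))
    (Real.exp_pos _).le

theorem exists_kernelTilde_le (hlam : ∀ l, 0 < lam l ∧ lam l < 1) :
    ∃ C, 0 ≤ C ∧ ∀ ξ η, kernelTilde lam ξ η ≤
      C * (gaussWeight lam ξ ^ 4 * gaussWeight lam η ^ 4) := by
  refine ⟨2 * ∏ l, √(1 / (4 * Real.pi * Real.sinh (decay (lam l)))),
    mul_nonneg zero_le_two (Finset.prod_nonneg fun _ _ => Real.sqrt_nonneg _), fun ξ η => ?_⟩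
  exact mul_le_mul_of_nonneg_left (gaussian_le hlam ξ η)
    (mul_nonneg zero_le_two (Finset.prod_nonneg fun _ _ => Real.sqrt_nonneg _))

theorem norm_cosh_le (w : ℂ) : ‖Complex.cosh w‖ ≤ Real.exp ‖w‖ := by
  rw [Complex.cosh, norm_div, Complex.norm_ofNat, div_le_iff₀ two_pos]
  refine (norm_add_le _ _).trans ?_
  rw [Complex.norm_exp, Complex.norm_exp]
  have h1 := Real.exp_le_exp.2 (Complex.re_le_norm w)
  have h2 := Real.exp_le_exp.2 (Complex.re_le_norm (-w))
  rw [norm_neg] at h2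
  linarith

theorem norm_coshRoot_le (β : ℂ) (J : Fin m → ℝ) (ξ : Fin m → ℝ) :
    ‖coshRoot β J ξ‖ ≤ Real.exp (∑ l, ‖rootCoupling β J l‖ * ‖ξ l‖) := by
  refine (norm_cosh_le _).trans (Real.exp_le_exp.2 (norm_sum_le_of_le _ fun l _ => ?_))
  rw [norm_mul, Complex.norm_real]

theorem norm_sqrtCoshRoot_le (β : ℂ) (J : Fin m → ℝ) (ξ : Fin m → ℝ) :
    ‖sqrtCoshRoot β J ξ‖ ≤ Real.exp (∑ l, ‖rootCoupling β J l‖ * ‖ξ l‖) := by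
  have h1 : ‖sqrtCoshRoot β J ξ‖ ^ 2 ≤ Real.exp (∑ l, ‖rootCoupling β J l‖ * ‖ξ l‖) := by
    rw [← norm_pow, sq, sqrtCoshRoot_mul_self]
    exact norm_coshRoot_le β J ξ
  refine le_of_sq_le_sq (h1.trans ?_) (Real.exp_pos _).le
  have h2 : 1 ≤ Real.exp (∑ l, ‖rootCoupling β J l‖ * ‖ξ l‖) :=
    Real.one_le_exp (Finset.sum_nonneg fun l _ => by positivity)
  nlinarith

theorem exists_exp_mul_gaussWeight_le (hlam : ∀ l, 0 < lam l ∧ lam l < 1) (b : Fin m → ℝ) :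
    ∃ C, 0 ≤ C ∧ ∀ ξ, Real.exp (∑ l, b l * ‖ξ l‖) * gaussWeight lam ξ ≤ C := by
  refine ⟨Real.exp (∑ l, 4 * b l ^ 2 / ((1 - lam l) / (1 + lam l))), (Real.exp_pos _).le,
    fun ξ => ?_⟩
  rw [gaussWeight, ← Real.exp_add, ← Finset.sum_add_distrib]
  refine Real.exp_le_exp.2 (Finset.sum_le_sum fun l _ => ?_)
  have h1 := sub_pos.2 (hlam l).2
  have h2 := (hlam l).1
  set t := (1 - lam l) / (1 + lam l)
  have ht : 0 < t := by positivity
  have h3 : 4 * b l ^ 2 / t - (b l * ‖ξ l‖ + -(t / 16) * ‖ξ l‖ ^ 2) =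
      (8 * b l - t * ‖ξ l‖) ^ 2 / (16 * t) := by
    field_simp; ring
  have h4 : 0 ≤ (8 * b l - t * ‖ξ l‖) ^ 2 / (16 * t) := by positivity
  linarith

end Constants

/-! ### Boundedness of the kernel operators; spectra of `√c K √c` and `c K` -/

section Operators

variable {lam : Fin m → ℝ}

theorem measurable_mul_kernelTilde_mul {φ ψ : (Fin m → ℝ) → ℂ} (hφ : Measurable φ)
    (hψ : Measurable ψ) : StronglyMeasurable (Function.uncurry fun ξ η : Fin m → ℝ =>
      φ ξ * (kernelTilde lam ξ η : ℂ) * ψ η) := by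
  have h : Measurable fun p : (Fin m → ℝ) × (Fin m → ℝ) => (kernelTilde lam p.1 p.2 : ℂ) :=
    (Complex.continuous_ofReal.comp (continuous_kernelTilde lam)).measurable
  exact (((hφ.comp measurable_fst).mul h).mul (hψ.comp measurable_snd)).stronglyMeasurable

theorem exists_norm_mul_kernelTilde_mul_le (hlam : ∀ l, 0 < lam l ∧ lam l < 1)
    {φ ψ : (Fin m → ℝ) → ℂ} {A B : ℝ} (hA : ∀ ξ, ‖φ ξ‖ * gaussWeight lam ξ ^ 3 ≤ A)
    (hB : ∀ ξ, ‖ψ ξ‖ * gaussWeight lam ξ ^ 3 ≤ B) :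
    ∃ C, 0 ≤ C ∧ ∀ ξ η, ‖φ ξ * (kernelTilde lam ξ η : ℂ) * ψ η‖ ≤
      C * gaussWeight lam ξ * gaussWeight lam η := by
  obtain ⟨C, hC, h⟩ := exists_kernelTilde_le hlam
  have hA0 : 0 ≤ A := (mul_nonneg (norm_nonneg _) (pow_pos (gaussWeight_pos lam 0) 3).le).trans
    (hA 0)
  have hB0 : 0 ≤ B := (mul_nonneg (norm_nonneg _) (pow_pos (gaussWeight_pos lam 0) 3).le).trans
    (hB 0)
  refine ⟨C * (A * B), by positivity, fun ξ η => ?_⟩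
  have h1 := gaussWeight_pos lam ξ
  have h2 := gaussWeight_pos lam η
  rw [norm_mul, norm_mul, Complex.norm_real, Real.norm_of_nonneg (kernelTilde_nonneg lam ξ η)]
  calc ‖φ ξ‖ * kernelTilde lam ξ η * ‖ψ η‖
      ≤ ‖φ ξ‖ * (C * (gaussWeight lam ξ ^ 4 * gaussWeight lam η ^ 4)) * ‖ψ η‖ := by
        gcongr; exact h ξ η
    _ = C * ((‖φ ξ‖ * gaussWeight lam ξ ^ 3) * (‖ψ η‖ * gaussWeight lam η ^ 3)) *
        (gaussWeight lam ξ * gaussWeight lam η) := by ring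
    _ ≤ C * (A * B) * (gaussWeight lam ξ * gaussWeight lam η) := by
        gcongr
        · exact hA ξ
        · exact hB η
    _ = _ := by ring

theorem exists_isIntegralOperator_mul_kernelTilde_mul (hlam : ∀ l, 0 < lam l ∧ lam l < 1)
    {φ ψ : (Fin m → ℝ) → ℂ} (hφ : Measurable φ) (hψ : Measurable ψ)
    (hA : ∃ A, ∀ ξ, ‖φ ξ‖ * gaussWeight lam ξ ^ 3 ≤ A)
    (hB : ∃ B, ∀ ξ, ‖ψ ξ‖ * gaussWeight lam ξ ^ 3 ≤ B) :
    ∃ T : L2 m →L[ℂ] L2 m,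
      IsIntegralOperator (fun ξ η => φ ξ * (kernelTilde lam ξ η : ℂ) * ψ η) T := by
  obtain ⟨A, hA⟩ := hA
  obtain ⟨B, hB⟩ := hB
  obtain ⟨C, _, h⟩ := exists_norm_mul_kernelTilde_mul_le hlam hA hB
  exact exists_isIntegralOperator (measurable_mul_kernelTilde_mul hφ hψ)
    ((memLp_gaussWeight hlam).const_mul C) (memLp_gaussWeight hlam) h

theorem mul_gaussWeight_pow_three_le (hlam : ∀ l, 0 < lam l ∧ lam l < 1) {x C : ℝ}
    {ξ : Fin m → ℝ} (k : ℕ) (hk : k ≤ 3) (hx : 0 ≤ x) (h : x * gaussWeight lam ξ ^ k ≤ C) :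
    x * gaussWeight lam ξ ^ 3 ≤ C := by
  refine (mul_le_mul_of_nonneg_left ?_ hx).trans h
  exact pow_le_pow_of_le_one (gaussWeight_pos lam ξ).le (gaussWeight_le_one hlam ξ) hk

theorem exists_coshRoot_bound (hlam : ∀ l, 0 < lam l ∧ lam l < 1) (β : ℂ) (J : Fin m → ℝ) :
    ∃ C, ∀ ξ, ‖coshRoot β J ξ‖ * gaussWeight lam ξ ≤ C ∧
      ‖sqrtCoshRoot β J ξ‖ * gaussWeight lam ξ ≤ C := by
  obtain ⟨C, _, h⟩ := exists_exp_mul_gaussWeight_le hlam fun l => ‖rootCoupling β J l‖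
  refine ⟨C, fun ξ => ⟨le_trans ?_ (h ξ), le_trans ?_ (h ξ)⟩⟩
  · exact mul_le_mul_of_nonneg_right (norm_coshRoot_le β J ξ) (gaussWeight_pos lam ξ).le
  · exact mul_le_mul_of_nonneg_right (norm_sqrtCoshRoot_le β J ξ) (gaussWeight_pos lam ξ).le

/-- Each factor `(4π sinh γ_l)^{-1/2}` is half of `(π sinh γ_l)^{-1/2}`, so `m` of them together
with the leading `2` give `2^{1-m}`. -/
theorem kernelRescaled_eq (J : Fin m → ℝ) (β : ℂ)
    (ξ η : Fin m → ℝ) :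
    kernelRescaled lam J β ξ η = normalization lam J β * sqrtCoshRoot β J ξ *
      (kernelTilde lam ξ η : ℂ) * sqrtCoshRoot β J η := by
  have h1 : (2 * ∏ l, √(1 / (4 * Real.pi * Real.sinh (decay (lam l)))) : ℝ) =
      (2 ^ ((m : ℤ) - 1) * ∏ l, √(Real.pi * Real.sinh (decay (lam l))))⁻¹ := by
    have h2 : ∀ l, √(1 / (4 * Real.pi * Real.sinh (decay (lam l)))) =
        2⁻¹ * (√(Real.pi * Real.sinh (decay (lam l))))⁻¹ := fun l => by
      rw [one_div, Real.sqrt_inv, mul_assoc, Real.sqrt_mul (by norm_num), mul_inv,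
        show (4 : ℝ) = 2 ^ 2 by norm_num, Real.sqrt_sq zero_le_two]
    simp_rw [h2]
    rw [Finset.prod_mul_distrib, Finset.prod_const, Finset.card_univ, Fintype.card_fin,
      Finset.prod_inv_distrib, mul_inv, ← mul_assoc, ← zpow_neg, neg_sub, zpow_sub₀ two_ne_zero,
      zpow_one, zpow_natCast, inv_pow, div_eq_mul_inv]
  rw [kernelRescaled, kernelKac, kernelTilde, h1, div_eq_mul_inv]
  push_cast
  ring

/-- The spectral comparison of `√c K √c` and `c K` goes through a Gaussian `w`: with `W` and `X`
the multiplications by `w` and `√c w`, the operators factor as `√c K √c = W Z`, `c K = X Y` where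
`Z W = Y X`. -/
theorem spectrum_kernelRescaled_eq (hm : 0 < m) (hlam : ∀ l, 0 < lam l ∧ lam l < 1)
    (J : Fin m → ℝ) (β : ℂ) {G Gt : L2 m →L[ℂ] L2 m}
    (hG : IsIntegralOperator (kernelRescaled lam J β) G)
    (hGt : IsIntegralOperator (kernelModified lam J β) Gt) : spectrum ℂ G = spectrum ℂ Gt := by
  set n := normalization lam J β
  set w : (Fin m → ℝ) → ℂ := fun ξ => gaussWeight lam ξ
  have hwpos : ∀ ξ, (w ξ) ≠ 0 := fun ξ =>
    Complex.ofReal_ne_zero.2 (gaussWeight_pos lam ξ).ne'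
  have hwn : ∀ ξ, ‖w ξ‖ = gaussWeight lam ξ := fun ξ => by
    rw [Complex.norm_real, Real.norm_of_nonneg (gaussWeight_pos lam ξ).le]
  have hwm : Measurable w := Complex.measurable_ofReal.comp (continuous_gaussWeight lam).measurable
  have hc := measurable_sqrtCoshRoot β J
  have hc2 := (continuous_coshRoot β J).measurable
  obtain ⟨C, hC⟩ := exists_coshRoot_bound hlam β J
  have hb1 : ∃ A, ∀ ξ, ‖n * (w ξ)⁻¹ * sqrtCoshRoot β J ξ‖ * gaussWeight lam ξ ^ 3 ≤ A :=
    ⟨‖n‖ * C, fun ξ => mul_gaussWeight_pow_three_le hlam 2 (by norm_num) (norm_nonneg _) (by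
      have h := (gaussWeight_pos lam ξ).ne'
      calc _ = ‖n‖ * (‖sqrtCoshRoot β J ξ‖ * gaussWeight lam ξ) := by
            rw [norm_mul, norm_mul, norm_inv, hwn]; field_simp
        _ ≤ _ := mul_le_mul_of_nonneg_left (hC ξ).2 (norm_nonneg _))⟩
  have hb2 : ∃ A, ∀ ξ, ‖n * (w ξ)⁻¹ * coshRoot β J ξ‖ * gaussWeight lam ξ ^ 3 ≤ A :=
    ⟨‖n‖ * C, fun ξ => mul_gaussWeight_pow_three_le hlam 2 (by norm_num) (norm_nonneg _) (by
      have h := (gaussWeight_pos lam ξ).ne'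
      calc _ = ‖n‖ * (‖coshRoot β J ξ‖ * gaussWeight lam ξ) := by
            rw [norm_mul, norm_mul, norm_inv, hwn]; field_simp
        _ ≤ _ := mul_le_mul_of_nonneg_left (hC ξ).1 (norm_nonneg _))⟩
  have hb3 : ∃ A, ∀ ξ, ‖sqrtCoshRoot β J ξ‖ * gaussWeight lam ξ ^ 3 ≤ A :=
    ⟨C, fun ξ => mul_gaussWeight_pow_three_le hlam 1 (by norm_num) (norm_nonneg _) (by
      rw [pow_one]; exact (hC ξ).2)⟩
  have hb4 : ∃ A, ∀ ξ, ‖(fun _ => 1 : (Fin m → ℝ) → ℂ) ξ‖ * gaussWeight lam ξ ^ 3 ≤ A :=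
    ⟨1, fun ξ => mul_gaussWeight_pow_three_le hlam 0 (by norm_num) (norm_nonneg _) (by simp)⟩
  obtain ⟨W, hW⟩ := exists_mulOperator (φ := w) (C := 1) hwm.aestronglyMeasurable fun ξ => by
    rw [hwn]; exact gaussWeight_le_one hlam ξ
  obtain ⟨X, hX⟩ := exists_mulOperator (φ := fun ξ => sqrtCoshRoot β J ξ * w ξ) (C := C)
    (hc.mul hwm).aestronglyMeasurable fun ξ => by
      rw [norm_mul, hwn]; exact (hC ξ).2
  obtain ⟨Y, hY⟩ := exists_isIntegralOperator_mul_kernelTilde_mul hlam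
    ((measurable_const.mul hwm.inv).mul hc) measurable_const hb1 hb4
  obtain ⟨Z, hZ⟩ := exists_isIntegralOperator_mul_kernelTilde_mul hlam
    ((measurable_const.mul hwm.inv).mul hc) hc hb1 hb3
  obtain ⟨Z', hZ'⟩ := exists_isIntegralOperator_mul_kernelTilde_mul hlam
    ((measurable_const.mul hwm.inv).mul hc2) measurable_const hb2 hb4
  have e1 : G = W * Z := hG.ext <| by
    convert hZ.mul_left hW using 1
    ext ξ η
    rw [kernelRescaled_eq]
    have := hwpos ξ
    simp only [Pi.mul_apply, Pi.inv_apply]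
    field_simp
  have e2 : Gt = X * Y := hGt.ext <| by
    convert hY.mul_left hX using 1
    ext ξ η
    rw [kernelModified, ← sqrtCoshRoot_mul_self]
    have := hwpos ξ
    simp only [Pi.mul_apply, Pi.inv_apply]
    field_simp
  have e3 : Z * W = Y * X := (hZ.mul_right hW).ext <| by
    convert hY.mul_right hX using 1
    ext ξ η
    ring
  -- A second factorisation, because the argument for `0` needs a multiplier without zeros, and `√c
  -- w` in `X` may vanish.
  have e4 : Gt = W * Z' := hGt.ext <| by
    convert hZ'.mul_left hW using 1
    ext ξ η
    rw [kernelModified]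
    have := hwpos ξ
    simp only [Pi.mul_apply, Pi.inv_apply]
    field_simp
  have hwL : MemLp w 2 := (memLp_gaussWeight hlam).ofReal
  have h1 : (0 : ℂ) ∈ spectrum ℂ G := e1 ▸ zero_mem_spectrum_mul hm hwL hwpos hW Z
  have h2 : (0 : ℂ) ∈ spectrum ℂ Gt := e4 ▸ zero_mem_spectrum_mul hm hwL hwpos hW Z'
  have h3 : spectrum ℂ G \ {0} = spectrum ℂ Gt \ {0} := by
    rw [e1, spectrum.nonzero_mul_comm, e3, spectrum.nonzero_mul_comm, e2]
  rw [← Set.insert_sdiff_self_of_mem h1, h3, Set.insert_sdiff_self_of_mem h2]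

end Operators

/-! ### The Bargmann transform intertwines the modified Kac–Gutzwiller and Ruelle operators -/

section Intertwining

variable {lam : Fin m → ℝ}

/-- Since `sinh γ_l = (1 - lam_l²) / (2 lam_l)`, the square roots from the normalisation, from the
Kac kernel and from the Gaussian integral multiply to `1`, and only `e^{-β J_l / 2}` survives. -/
theorem normalization_mul_prod (hlam : ∀ l, 0 < lam l ∧ lam l < 1) (J : Fin m → ℝ) (β : ℂ) :
    normalization lam J β * (∏ l, √(1 / (4 * Real.pi * Real.sinh (decay (lam l)))) : ℝ) *
      ∏ l, ((Real.pi : ℂ) / ((1 / (2 * (1 - lam l ^ 2)) : ℝ) : ℂ)) ^ (1 / 2 : ℂ) =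
      Complex.exp (-∑ l, β * J l / 2) := by
  rw [normalization, Complex.ofReal_prod, ← Finset.prod_mul_distrib, ← Finset.prod_mul_distrib,
    ← Finset.sum_neg_distrib, Complex.exp_sum]
  refine Finset.prod_congr rfl fun l _ => ?_
  obtain ⟨h0, h1⟩ := hlam l
  have h2 : 0 < 1 - lam l ^ 2 := by nlinarith
  have h3 : ((Real.pi : ℂ) / ((1 / (2 * (1 - lam l ^ 2)) : ℝ) : ℂ)) ^ (1 / 2 : ℂ) =
      ((√(Real.pi / (1 / (2 * (1 - lam l ^ 2)))) : ℝ) : ℂ) := by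
    rw [Real.sqrt_eq_rpow, Complex.ofReal_cpow (by positivity)]
    push_cast; rfl
  rw [h3]
  have h4 : (√(lam l))⁻¹ * √(1 / (4 * Real.pi * Real.sinh (decay (lam l)))) *
      √(Real.pi / (1 / (2 * (1 - lam l ^ 2)))) = 1 := by
    rw [sinh_decay h0, ← Real.sqrt_inv, ← Real.sqrt_mul (by positivity),
      ← Real.sqrt_mul (by positivity), Real.sqrt_eq_one]
    have := Real.pi_pos
    field_simp
    norm_num
  have h5 := congrArg Complex.ofReal h4
  rw [Complex.ofReal_mul, Complex.ofReal_mul, Complex.ofReal_one] at h5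
  linear_combination Complex.exp (-(β * J l / 2)) * h5

/-- The coefficients of `ξ_l²` add up to `1 / (2 (1 - lam_l²))`. Completing the square leaves `ε
s_l² z_l - s_l² lam_l² (z_l + ε)² / 2` in the part free of `η`, where the surviving `e^{-β J_l / 2}`
is what completes the square in `z_l + ε`. Taking `ε = ±1` gives the two branches of the Ruelle
operator. -/
theorem integral_bargmannKernel_mul_gaussian (hlam : ∀ l, 0 < lam l ∧ lam l < 1)
    (J : Fin m → ℝ) (β : ℂ) {ε : ℂ} (hε : ε ^ 2 = 1) (z : Fin m → ℂ) (η : Fin m → ℝ) :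
    Integrable (fun ξ => bargmannKernel (fun l => rootCoupling β J l * z l) ξ *
      (Complex.exp (ε * ∑ l, rootCoupling β J l * ξ l) * (gaussian lam ξ η : ℂ))) ∧
    normalization lam J β * (∏ l, √(1 / (4 * Real.pi * Real.sinh (decay (lam l)))) : ℝ) *
      ∫ ξ, bargmannKernel (fun l => rootCoupling β J l * z l) ξ *
        (Complex.exp (ε * ∑ l, rootCoupling β J l * ξ l) * (gaussian lam ξ η : ℂ)) =
      Complex.exp (ε * (β * ∑ l, J l * z l)) *
        bargmannKernel (fun l => rootCoupling β J l * (lam l * z l + ε * lam l)) η := by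
  set s := rootCoupling β J
  have hpos : ∀ l, 0 < 1 - lam l ^ 2 := fun l => by nlinarith [hlam l]
  have hb : ∀ l, 0 < ((1 / (2 * (1 - lam l ^ 2)) : ℝ) : ℂ).re := fun l => by
    rw [Complex.ofReal_re]; have := hpos l; positivity
  set c : Fin m → ℂ := fun l => s l * (z l + ε) + (lam l / (1 - lam l ^ 2) : ℝ) * η l
  have h1 : ∀ ξ : Fin m → ℝ, bargmannKernel (fun l => s l * z l) ξ *
      (Complex.exp (ε * ∑ l, s l * ξ l) * (gaussian lam ξ η : ℂ)) =
      Complex.exp (∑ l, (-((1 / 4 * ((1 + lam l ^ 2) / (1 - lam l ^ 2)) : ℝ) : ℂ) * (η l : ℂ) ^ 2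
        - (s l * z l) ^ 2 / 2)) *
      Complex.exp (-∑ l, ((1 / (2 * (1 - lam l ^ 2)) : ℝ) : ℂ) * (ξ l : ℂ) ^ 2 +
        ∑ l, c l * ξ l) := by
    intro ξ
    rw [gaussian_eq hlam, bargmannKernel, Complex.ofReal_exp, ← Complex.exp_add,
      ← Complex.exp_add, ← Complex.exp_add]
    congr 1
    push_cast
    rw [Finset.mul_sum, ← Finset.sum_neg_distrib, ← Finset.sum_add_distrib,
      ← Finset.sum_add_distrib, ← Finset.sum_add_distrib, ← Finset.sum_add_distrib]
    refine Finset.sum_congr rfl fun l _ => ?_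
    have h2 : (1 - (lam l : ℂ) ^ 2) ≠ 0 := by exact_mod_cast (hpos l).ne'
    simp only [c]
    push_cast
    field_simp
    ring
  simp_rw [h1]
  refine ⟨(GaussianFourier.integrable_cexp_neg_sum_mul_add hb c).const_mul _, ?_⟩
  rw [integral_const_mul, GaussianFourier.integral_cexp_neg_sum_mul_add hb,
    Finset.prod_mul_distrib, mul_left_comm, ← mul_assoc (normalization lam J β * _),
    normalization_mul_prod hlam, ← Complex.exp_sum, ← Complex.exp_add, ← Complex.exp_add,
    bargmannKernel, ← Complex.exp_add]
  congr 1
  rw [Finset.mul_sum, Finset.mul_sum, ← Finset.sum_neg_distrib, ← Finset.sum_add_distrib,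
    ← Finset.sum_add_distrib, ← Finset.sum_add_distrib]
  refine Finset.sum_congr rfl fun l _ => ?_
  have h2 : (1 - (lam l : ℂ) ^ 2) ≠ 0 := by exact_mod_cast (hpos l).ne'
  have hs : s l ^ 2 = β * J l := rootCoupling_sq β J l
  rw [← mul_assoc β, ← hs]
  simp only [c]
  push_cast
  field_simp
  linear_combination (4 * s l ^ 2 * (1 - (lam l : ℂ) ^ 2)) * hε

/-- Fubini reduces the claim to the kernel identity for `ε = ±1`; the factor `2` of `kernelTilde`
cancels the `1/2` in the hyperbolic cosine. -/
theorem bargmann_modified (hlam : ∀ l, 0 < lam l ∧ lam l < 1) (J : Fin m → ℝ) (β : ℂ)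
    {Gt : L2 m →L[ℂ] L2 m} (hGt : IsIntegralOperator (kernelModified lam J β) Gt) (g : L2 m)
    (z : Fin m → ℂ) :
    bargmann (rootCoupling β J) (Gt g) z =
      Complex.exp (β * ∑ l, J l * z l) *
        bargmann (rootCoupling β J) g (fun l => lam l * z l + lam l) +
      Complex.exp (-(β * ∑ l, J l * z l)) *
        bargmann (rootCoupling β J) g (fun l => lam l * z l - lam l) := by
  set s := rootCoupling β J with hs
  set κ := bargmannKernel fun l => s l * z l with hκ
  set κp := bargmannKernel fun l => s l * (lam l * z l + lam l)
  set κm := bargmannKernel fun l => s l * (lam l * z l - lam l)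
  set a := Complex.exp (β * ∑ l, J l * z l)
  set b := Complex.exp (-(β * ∑ l, J l * z l))
  have hinner : ∀ η, ∫ ξ, κ ξ * kernelModified lam J β ξ η = a * κp η + b * κm η := by
    intro η
    obtain ⟨i1, e1⟩ := integral_bargmannKernel_mul_gaussian hlam J β (ε := 1) (by norm_num) z η
    obtain ⟨i2, e2⟩ := integral_bargmannKernel_mul_gaussian hlam J β (ε := -1) (by norm_num) z η
    have e1' : _ = a * κp η := e1.trans (by simp only [one_mul, a, κp, s])
    have e2' : _ = b * κm η := e2.trans (by
      simp only [neg_one_mul, b, κm, s, sub_eq_add_neg])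
    rw [← e1', ← e2', ← mul_add, ← integral_add i1 i2, ← integral_const_mul]
    refine integral_congr_ae (Filter.Eventually.of_forall fun ξ => ?_)
    simp only [kernelModified, kernelTilde, coshRoot, Complex.cosh, ← hs, ← hκ, one_mul,
      neg_one_mul]
    push_cast
    ring
  obtain ⟨C, hC⟩ := exists_coshRoot_bound hlam β J
  have hkm : StronglyMeasurable (Function.uncurry (kernelModified lam J β)) := by
    have := measurable_mul_kernelTilde_mul (lam := lam) (ψ := fun _ => 1)
      ((continuous_coshRoot β J).measurable.const_mul (normalization lam J β)) measurable_const
    simp only [mul_one] at this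
    exact this
  obtain ⟨D, hD, hDb⟩ := exists_norm_mul_kernelTilde_mul_le hlam
    (φ := fun ξ => normalization lam J β * coshRoot β J ξ) (ψ := fun _ => 1)
    (A := ‖normalization lam J β‖ * C) (B := 1)
    (fun ξ => mul_gaussWeight_pow_three_le hlam 1 (by norm_num) (norm_nonneg _) (by
      rw [norm_mul, mul_assoc, pow_one]
      exact mul_le_mul_of_nonneg_left (hC ξ).1 (norm_nonneg _)))
    (fun ξ => mul_gaussWeight_pow_three_le hlam 0 (by norm_num) (norm_nonneg _) (by simp))
  simp only [mul_one] at hDb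
  have hprod : Integrable (Function.uncurry fun ξ η : Fin m → ℝ =>
      κ ξ * (kernelModified lam J β ξ η * g η)) (volume.prod volume) := by
    have i1 : Integrable fun ξ => D * (‖κ ξ‖ * gaussWeight lam ξ) :=
      ((memLp_bargmannKernel _).norm.integrable_mul (memLp_gaussWeight hlam)).const_mul D
    have i2 : Integrable fun η => gaussWeight lam η * ‖g η‖ :=
      (memLp_gaussWeight hlam).integrable_mul (Lp.memLp g).norm
    refine (i1.mul_prod i2).mono' ?_ (Filter.Eventually.of_forall fun p => ?_)
    · have m1 : StronglyMeasurable fun p : (Fin m → ℝ) × (Fin m → ℝ) => κ p.1 :=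
        ((continuous_bargmannKernel _).comp continuous_fst).stronglyMeasurable
      have m2 : StronglyMeasurable fun p : (Fin m → ℝ) × (Fin m → ℝ) => g p.2 :=
        (Lp.stronglyMeasurable g).comp_measurable measurable_snd
      exact (m1.mul (hkm.mul m2)).aestronglyMeasurable
    · rw [Function.uncurry, norm_mul, norm_mul]
      calc ‖κ p.1‖ * (‖kernelModified lam J β p.1 p.2‖ * ‖g p.2‖)
          ≤ ‖κ p.1‖ * ((D * gaussWeight lam p.1 * gaussWeight lam p.2) * ‖g p.2‖) := by
            gcongr; exact hDb _ _
        _ = _ := by ring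
  have h1 : ∫ ξ, κ ξ * Gt g ξ = ∫ η, (a * κp η + b * κm η) * g η := by
    calc ∫ ξ, κ ξ * Gt g ξ = ∫ ξ, ∫ η, κ ξ * (kernelModified lam J β ξ η * g η) := by
          refine integral_congr_ae ?_
          filter_upwards [(hGt g).2] with ξ h
          rw [h, integral_const_mul]
      _ = ∫ η, ∫ ξ, κ ξ * (kernelModified lam J β ξ η * g η) := integral_integral_swap hprod
      _ = _ := by
          refine integral_congr_ae (Filter.Eventually.of_forall fun η => ?_)
          dsimp only
          rw [← hinner, ← integral_mul_const]
          simp only [mul_assoc]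
  have ip : Integrable fun η => κp η * g η := integrable_bargmannKernel_mul _ g
  have im : Integrable fun η => κm η * g η := integrable_bargmannKernel_mul _ g
  simp only [bargmann]
  rw [h1]
  simp_rw [add_mul, mul_assoc]
  rw [integral_add (ip.const_mul a) (im.const_mul b), integral_const_mul, integral_const_mul]
  ring

end Intertwining

/-! ### The zeros of the hyperbolic cosine factor form a null set -/

section Zeros

/-- The zeros lie in countably many level sets of a nonzero real linear map to `ℂ`; each is empty or
a translate of a proper subspace. -/
theorem ae_coshRoot_ne_zero (hm : 0 < m) {β : ℂ} (hβ : β ≠ 0) {J : Fin m → ℝ}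
    (hJ : ∀ l, 0 < J l) : ∀ᵐ ξ, coshRoot β J ξ ≠ 0 := by
  set s := rootCoupling β J
  let φ : (Fin m → ℝ) →ₗ[ℝ] ℂ := ∑ l, (LinearMap.proj l).smulRight (s l)
  have hφ : ∀ ξ, φ ξ = ∑ l, s l * ξ l := fun ξ => by
    simp [φ, LinearMap.sum_apply, mul_comm]
  have hker : LinearMap.ker φ ≠ ⊤ := fun h => by
    have h1 : φ (Pi.single ⟨0, hm⟩ 1) = 0 := by
      rw [← LinearMap.mem_ker, h]; trivial
    rw [hφ, Finset.sum_eq_single ⟨0, hm⟩ (by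
      intro l _ hl; rw [Pi.single_eq_of_ne hl]; simp) (by simp)] at h1
    simp only [Pi.single_eq_same, Complex.ofReal_one, mul_one] at h1
    exact rootCoupling_ne_zero hβ hJ _ h1
  have hnull : ∀ c : ℂ, ∀ᵐ ξ, φ ξ ≠ c := by
    intro c
    rw [ae_iff]
    simp only [not_not]
    rcases Set.eq_empty_or_nonempty {ξ | φ ξ = c} with h | ⟨ξ₀, h0⟩
    · rw [h, measure_empty]
    · have : {ξ | φ ξ = c} = (fun ξ => ξ + -ξ₀) ⁻¹' (LinearMap.ker φ : Set (Fin m → ℝ)) := by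
        ext ξ
        simp only [Set.mem_preimage, SetLike.mem_coe, LinearMap.mem_ker, ← sub_eq_add_neg]
        rw [map_sub, sub_eq_zero]
        rw [show φ ξ₀ = c from h0]
        rfl
      rw [this, measure_preimage_add_right]
      exact Measure.addHaar_submodule _ _ hker
  have hall : ∀ᵐ ξ, ∀ k : ℤ, φ ξ ≠ -((2 * k + 1) * Real.pi / 2 * Complex.I) :=
    ae_all_iff.2 fun k => hnull _
  filter_upwards [hall] with ξ h h0
  rw [coshRoot, ← Complex.cos_mul_I, Complex.cos_eq_zero_iff] at h0
  obtain ⟨k, hk⟩ := h0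
  refine h k ?_
  rw [hφ, ← hk, mul_assoc, Complex.I_mul_I]
  ring

theorem sqrtCoshRoot_ne_zero {β : ℂ} {J : Fin m → ℝ} {ξ : Fin m → ℝ} (h : coshRoot β J ξ ≠ 0) :
    sqrtCoshRoot β J ξ ≠ 0 := fun h0 => h (by rw [← sqrtCoshRoot_mul_self, h0, zero_mul])

end Zeros

end KacBaker
end

noncomputable section
namespace KacBaker

variable {m : ℕ}

/-! ### Improved growth of Ruelle eigenfunctions -/

section Growth

theorem norm_exp_sum_le (c : ℂ) (J : Fin m → ℝ) (z : Fin m → ℂ) :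
    ‖Complex.exp (c * ∑ l, J l * z l)‖ ≤ Real.exp (∑ l, ‖c * J l‖ * ‖z l‖) := by
  rw [Complex.norm_exp]
  refine Real.exp_le_exp.2 ((Complex.re_le_norm _).trans ?_)
  rw [Finset.mul_sum]
  refine norm_sum_le_of_le _ fun l _ => ?_
  rw [← mul_assoc, norm_mul]

/-- The gap `1 - t²` in the quadratic coefficient is halved: one half absorbs the linear terms, the
other keeps the result below the critical coefficient `1`. -/
theorem add_sq_mul_le {x t : ℝ} (ht : 0 < t ∧ t < 1) :
    2 * x + t ^ 2 * (x + 1) ^ 2 ≤ (1 + t ^ 2) / 2 * x ^ 2 + (1 + 8 / (1 - t ^ 2)) := by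
  have h : 0 < 1 - t ^ 2 := by nlinarith
  rcases le_or_gt 0 x with hx | hx
  · have h1 : 8 / (1 - t ^ 2) + (1 - t ^ 2) / 2 * x ^ 2 - 4 * x =
        ((1 - t ^ 2) * x - 4) ^ 2 / (2 * (1 - t ^ 2)) := by field_simp; ring
    have h2 : 0 ≤ ((1 - t ^ 2) * x - 4) ^ 2 / (2 * (1 - t ^ 2)) := by positivity
    nlinarith
  · have h1 : 0 ≤ 8 / (1 - t ^ 2) := by positivity
    nlinarith [mul_nonneg h.le (sq_nonneg x), mul_nonneg (sq_nonneg t) (neg_nonneg.2 hx.le)]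

variable {lam J : Fin m → ℝ} {β : ℂ}

theorem norm_rootCoupling_sq (l : Fin m) : ‖rootCoupling β J l‖ ^ 2 = ‖β * J l‖ := by
  rw [← norm_pow, rootCoupling_sq]

theorem pi_mul_norm_invAlpha_mul_sq (z : Fin m → ℂ) (l : Fin m) :
    Real.pi * ‖invAlpha β J l * z l‖ ^ 2 = ‖rootCoupling β J l‖ ^ 2 * ‖z l‖ ^ 2 := by
  rw [invAlpha, norm_mul, norm_div, Complex.norm_real, Real.norm_of_nonneg (Real.sqrt_nonneg _),
    mul_pow, div_pow, Real.sq_sqrt Real.pi_pos.le]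
  have := Real.pi_ne_zero
  field_simp

theorem norm_exp_mul_apply_le (hlam : ∀ l, 0 < lam l ∧ lam l < 1) {F : (Fin m → ℂ) → ℂ} {K : ℝ}
    (hK : ∀ w, ‖F w‖ ≤ K * Real.exp (Real.pi / 2 * ∑ l, ‖invAlpha β J l * w l‖ ^ 2))
    (hK0 : 0 ≤ K) {c ε : ℂ} (hc : ‖c‖ = ‖β‖) (hε : ‖ε‖ = 1) (z : Fin m → ℂ) :
    ‖Complex.exp (c * ∑ l, J l * z l) * F (fun l => lam l * z l + ε * lam l)‖ ≤
      K * Real.exp (∑ l, ‖rootCoupling β J l‖ ^ 2 / 2 * (1 + 8 / (1 - lam l ^ 2))) *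
        Real.exp (∑ l, (1 + lam l ^ 2) / 2 / 2 * (‖rootCoupling β J l‖ ^ 2 * ‖z l‖ ^ 2)) := by
  rw [norm_mul]
  refine (mul_le_mul (norm_exp_sum_le c J z) (hK _) (norm_nonneg _) (Real.exp_pos _).le).trans ?_
  rw [mul_left_comm, mul_assoc]
  refine mul_le_mul_of_nonneg_left ?_ hK0
  rw [← Real.exp_add, ← Real.exp_add, Finset.mul_sum, ← Finset.sum_add_distrib,
    ← Finset.sum_add_distrib]
  refine Real.exp_le_exp.2 (Finset.sum_le_sum fun l _ => ?_)
  have h1 : ‖c * J l‖ = ‖rootCoupling β J l‖ ^ 2 := by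
    rw [norm_rootCoupling_sq, norm_mul, norm_mul, hc]
  have h2 := pi_mul_norm_invAlpha_mul_sq (β := β) (J := J)
    (fun l => lam l * z l + ε * lam l) l
  have h3 : ‖lam l * z l + ε * lam l‖ ≤ lam l * (‖z l‖ + 1) := by
    refine (norm_add_le _ _).trans (le_of_eq ?_)
    rw [norm_mul, norm_mul, hε, Complex.norm_real, Real.norm_of_nonneg (hlam l).1.le]
    ring
  have h4 : ‖lam l * z l + ε * lam l‖ ^ 2 ≤ lam l ^ 2 * (‖z l‖ + 1) ^ 2 := by
    rw [← mul_pow]; gcongr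
  have h5 := add_sq_mul_le (x := ‖z l‖) (hlam l)
  rw [h1, div_mul_eq_mul_div, h2]
  have h6 : 0 ≤ ‖rootCoupling β J l‖ ^ 2 / 2 := by positivity
  have h7 := mul_le_mul_of_nonneg_left ((add_le_add_right h4 (2 * ‖z l‖)).trans h5) h6
  linarith

/-- Eigenfunctions of the Ruelle operator grow more slowly than a general element of the Fock
space. -/
theorem exists_norm_apply_le_of_eigen (hlam : ∀ l, 0 < lam l ∧ lam l < 1) (hβ : β ≠ 0)
    (hJ : ∀ l, 0 < J l) {L : Fock (invAlpha β J) →L[ℂ] Fock (invAlpha β J)}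
    (hL : IsRuelleOperator lam J β L) {ρ : ℂ} (hρ : ρ ≠ 0) {F : Fock (invAlpha β J)}
    (hF : L F = ρ • F) :
    ∃ D, ∀ z, ‖F z‖ ≤
      D * Real.exp (∑ l, (1 + lam l ^ 2) / 2 / 2 * (‖rootCoupling β J l‖ ^ 2 * ‖z l‖ ^ 2)) := by
  have hα : ∀ l, invAlpha β J l ≠ 0 := fun l => div_ne_zero (rootCoupling_ne_zero hβ hJ l)
    (by exact_mod_cast (Real.sqrt_pos.2 Real.pi_pos).ne')
  obtain ⟨K, hK0, hK⟩ := F.exists_norm_apply_le hα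
  refine ⟨‖ρ‖⁻¹ * (2 * (K * Real.exp (∑ l, ‖rootCoupling β J l‖ ^ 2 / 2 *
    (1 + 8 / (1 - lam l ^ 2))))), fun z => ?_⟩
  -- In `ρ F = L F` the right side evaluates `F` at contracted points, so the general pointwise
  -- bound inserted there comes out with the smaller exponent.
  have h1 := hL F z
  rw [hF, map_smul, Pi.smul_apply, smul_eq_mul] at h1
  have h2 := norm_exp_mul_apply_le hlam hK hK0 (c := β) (ε := 1) rfl norm_one z
  have h3 := norm_exp_mul_apply_le hlam hK hK0 (c := -β) (ε := -1) (norm_neg β) (by simp) z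
  simp only [one_mul, ← sub_eq_add_neg, neg_mul] at h2 h3
  have h4 := (norm_add_le _ _).trans (add_le_add h2 h3)
  rw [← h1, norm_mul] at h4
  rw [mul_assoc, ← div_eq_inv_mul, le_div_iff₀ (norm_pos_iff.2 hρ)]
  linarith

end Growth

/-! ### Inversion of the Bargmann transform by an absolutely convergent integral -/

section Inversion

variable {J : Fin m → ℝ} {β : ℂ}

theorem kacIntegrand_eq (F : (Fin m → ℂ) → ℂ) (ξ : Fin m → ℝ) (z : Fin m → ℂ) :
    kacIntegrand J β F ξ z = F (fun l => (invAlpha β J l)⁻¹ * z l) *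
      (starRingEnd ℂ (bargmannKernel (fun l => √Real.pi * z l) ξ) *
        Complex.exp (-fockPairing 1 z z)) := by
  have h : (√Real.pi : ℂ) ^ 2 = Real.pi := by
    rw [← Complex.ofReal_pow, Real.sq_sqrt Real.pi_pos.le]
  rw [kacIntegrand, bargmannKernel, ← Complex.exp_conj, ← Complex.exp_add, fockPairing_self]
  congr 2
  simp only [map_sum, map_sub, map_mul, map_div₀, map_pow, Complex.conj_ofReal, map_ofNat,
    mul_pow, h, Pi.one_apply, one_mul]
  push_cast
  simp only [Finset.mul_sum, Complex.star_def]
  rw [← Finset.sum_neg_distrib, ← Finset.sum_add_distrib, ← Finset.sum_sub_distrib,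
    ← Finset.sum_sub_distrib, ← Finset.sum_sub_distrib]
  refine Finset.sum_congr rfl fun l _ => ?_
  ring

/-- At `θ = 1` the left side equals `-(ξ - p x)² / 2 - p² x² / 2`, without any decay in `y`; this is
why the improved growth of eigenfunctions is needed. The extra `-ξ²/4` gives joint decay in `ξ` for
Fubini. -/
theorem exponent_bound {p x y ξ θ : ℝ} (h0 : 0 ≤ θ) (h1 : θ < 1) :
    θ * p ^ 2 / 2 * (x ^ 2 + y ^ 2) + (p * x * ξ - ξ ^ 2 / 4 - p ^ 2 * (x ^ 2 - y ^ 2) / 2) -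
        p ^ 2 * (x ^ 2 + y ^ 2) - 1 / 4 * ξ ^ 2 ≤
      -((1 - θ) / 8) * ξ ^ 2 + -((1 - θ) * p ^ 2 / 4) * (x ^ 2 + y ^ 2) := by
  have e1 : 0 ≤ (1 / 2 - (1 - θ) / 4) * (ξ - p * x) ^ 2 :=
    mul_nonneg (by linarith) (sq_nonneg _)
  have e2 : 0 ≤ (1 - θ) / 8 * (ξ - p * x - p * x) ^ 2 := mul_nonneg (by linarith) (sq_nonneg _)
  have e3 : 0 ≤ (1 - θ) / 4 * (p * y) ^ 2 := mul_nonneg (by linarith) (sq_nonneg _)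
  nlinarith [sq_nonneg (p * x)]

theorem norm_kacIntegrand_le {F : (Fin m → ℂ) → ℂ} {D : ℝ} {θ : Fin m → ℝ}
    (h0 : ∀ l, 0 ≤ θ l) (h1 : ∀ l, θ l < 1)
    (hD : ∀ z : Fin m → ℂ, ‖F fun l => (invAlpha β J l)⁻¹ * z l‖ ≤
      D * Real.exp (∑ l, θ l * Real.pi / 2 * ‖z l‖ ^ 2)) (ξ : Fin m → ℝ) (z : Fin m → ℂ) :
    ‖kacIntegrand J β F ξ z‖ * Real.exp (-(1 / 4) * ∑ l, ξ l ^ 2) ≤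
      D * (Real.exp (∑ l, -((1 - θ l) / 8) * ‖ξ l‖ ^ 2) *
        Real.exp (∑ l, -((1 - θ l) * Real.pi / 4) * ‖z l‖ ^ 2)) := by
  have hD0 : 0 ≤ D := nonneg_of_mul_nonneg_left ((norm_nonneg _).trans (hD 0)) (Real.exp_pos _)
  rw [kacIntegrand_eq, norm_mul, mul_assoc]
  refine (mul_le_mul_of_nonneg_right (hD z) (by positivity)).trans ?_
  rw [mul_assoc]
  refine mul_le_mul_of_nonneg_left ?_ hD0
  rw [norm_mul, Complex.norm_conj, bargmannKernel, Complex.norm_exp, Complex.norm_exp,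
    fockPairing_self, ← Complex.ofReal_neg, Complex.ofReal_re, ← Real.exp_add, ← Real.exp_add,
    ← Real.exp_add, ← Real.exp_add, Complex.re_sum, Finset.mul_sum, Finset.mul_sum,
    ← Finset.sum_neg_distrib, ← Finset.sum_add_distrib, ← Finset.sum_add_distrib,
    ← Finset.sum_add_distrib, ← Finset.sum_add_distrib]
  refine Real.exp_le_exp.2 (Finset.sum_le_sum fun l _ => ?_)
  have h2 := exponent_bound (p := √Real.pi) (x := (z l).re) (y := (z l).im) (ξ := ξ l)
    (h0 l) (h1 l)
  have h3 : ‖z l‖ ^ 2 = (z l).re ^ 2 + (z l).im ^ 2 := by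
    rw [Complex.sq_norm, Complex.normSq_apply]; ring
  have h4 : ((√Real.pi * z l * ξ l - (ξ l : ℂ) ^ 2 / 4 - (√Real.pi * z l) ^ 2 / 2 : ℂ)).re =
      √Real.pi * (z l).re * ξ l - ξ l ^ 2 / 4 -
        √Real.pi ^ 2 * ((z l).re ^ 2 - (z l).im ^ 2) / 2 := by
    rw [mul_pow, ← Complex.ofReal_pow, ← Complex.ofReal_pow, Complex.sub_re, Complex.sub_re,
      Complex.re_mul_ofReal, Complex.re_ofReal_mul,
      show ((ξ l ^ 2 : ℝ) : ℂ) / 4 = ((ξ l ^ 2 / 4 : ℝ) : ℂ) by push_cast; rfl, Complex.ofReal_re,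
      show ((√Real.pi ^ 2 : ℝ) : ℂ) * z l ^ 2 / 2 = ((√Real.pi ^ 2 / 2 : ℝ) : ℂ) * z l ^ 2 by
        push_cast; ring, Complex.re_ofReal_mul, sq (z l), Complex.mul_re]
    ring
  rw [Real.sq_sqrt Real.pi_pos.le] at h2 h4
  rw [h4, Pi.one_apply, one_mul, h3, Real.norm_eq_abs, sq_abs]
  linarith

theorem continuous_kacIntegrand {F : (Fin m → ℂ) → ℂ} (hF : Continuous F) :
    Continuous fun p : (Fin m → ℝ) × (Fin m → ℂ) => kacIntegrand J β F p.1 p.2 := by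
  unfold kacIntegrand
  fun_prop

theorem integrable_exp_sum_neg_sq {V : Type*} [NormedAddCommGroup V] [InnerProductSpace ℝ V]
    [FiniteDimensional ℝ V] [MeasurableSpace V] [BorelSpace V] {a : Fin m → ℝ}
    (ha : ∀ l, 0 < a l) :
    Integrable fun z : Fin m → V => Real.exp (∑ l, -a l * ‖z l‖ ^ 2) := by
  have h := integrable_exp_sum_neg_sq_add (V := V) ha 0
  simp only [Pi.zero_apply, zero_mul, add_zero] at h
  exact h

theorem integrable_kacIntegrand {F : (Fin m → ℂ) → ℂ} (hF : Continuous F) {D : ℝ}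
    {θ : Fin m → ℝ} (h0 : ∀ l, 0 ≤ θ l) (h1 : ∀ l, θ l < 1)
    (hD : ∀ z : Fin m → ℂ, ‖F fun l => (invAlpha β J l)⁻¹ * z l‖ ≤
      D * Real.exp (∑ l, θ l * Real.pi / 2 * ‖z l‖ ^ 2)) (ξ : Fin m → ℝ) :
    Integrable (kacIntegrand J β F ξ) := by
  have h2 : Integrable fun z : Fin m → ℂ =>
      Real.exp (∑ l, -((1 - θ l) * Real.pi / 4) * ‖z l‖ ^ 2) :=
    integrable_exp_sum_neg_sq fun l => by
      have := sub_pos.2 (h1 l)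
      have := Real.pi_pos
      positivity
  refine (h2.const_mul ((Real.exp (-(1 / 4) * ∑ l, ξ l ^ 2))⁻¹ *
    (D * Real.exp (∑ l, -((1 - θ l) / 8) * ‖ξ l‖ ^ 2)))).mono'
    (Continuous.aestronglyMeasurable (by
      exact (continuous_kacIntegrand hF).comp (continuous_const.prodMk continuous_id)))
    (Filter.Eventually.of_forall fun z => ?_)
  rw [mul_assoc, ← div_eq_inv_mul, le_div_iff₀ (Real.exp_pos _), mul_assoc]
  exact norm_kacIntegrand_le h0 h1 hD ξ z

theorem integrable_exp_mul_kacIntegrand {F : (Fin m → ℂ) → ℂ} (hF : Continuous F) {D : ℝ}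
    {θ : Fin m → ℝ} (h0 : ∀ l, 0 ≤ θ l) (h1 : ∀ l, θ l < 1)
    (hD : ∀ z : Fin m → ℂ, ‖F fun l => (invAlpha β J l)⁻¹ * z l‖ ≤
      D * Real.exp (∑ l, θ l * Real.pi / 2 * ‖z l‖ ^ 2)) :
    Integrable (fun p : (Fin m → ℝ) × (Fin m → ℂ) =>
      ((Real.exp (-(1 / 4) * ∑ l, p.1 l ^ 2) : ℝ) : ℂ) * kacIntegrand J β F p.1 p.2)
      (volume.prod volume) := by
  have h2 : Integrable fun z : Fin m → ℂ =>
      Real.exp (∑ l, -((1 - θ l) * Real.pi / 4) * ‖z l‖ ^ 2) :=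
    integrable_exp_sum_neg_sq fun l => by
      have := sub_pos.2 (h1 l)
      have := Real.pi_pos
      positivity
  have h3 : Integrable fun ξ : Fin m → ℝ => Real.exp (∑ l, -((1 - θ l) / 8) * ‖ξ l‖ ^ 2) :=
    integrable_exp_sum_neg_sq fun l => by
      have := sub_pos.2 (h1 l)
      positivity
  refine ((h3.mul_prod h2).const_mul D).mono' (Continuous.aestronglyMeasurable ?_)
    (Filter.Eventually.of_forall fun p => ?_)
  · have := continuous_kacIntegrand (J := J) (β := β) hF
    fun_prop
  · rw [norm_mul, Complex.norm_real, Real.norm_eq_abs, Real.abs_exp, mul_comm]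
    exact norm_kacIntegrand_le h0 h1 hD p.1 p.2

/-- Both sides are tested against the kernels at `t = i y`. By Fubini the inner `ξ`-integral becomes
a conjugate reproducing kernel, and the reproducing property recovers the rescaled transform of `g`
at `i y / √π`, which is the test of `g` itself. -/
theorem bargmannConst_mul_integral_kacIntegrand (hβ : β ≠ 0) (hJ : ∀ l, 0 < J l) {D : ℝ}
    {θ : Fin m → ℝ} (h0 : ∀ l, 0 ≤ θ l) (h1 : ∀ l, θ l < 1) (g : L2 m)
    (hD : ∀ z : Fin m → ℂ, ‖bargmann (rootCoupling β J) g fun l => (invAlpha β J l)⁻¹ * z l‖ ≤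
      D * Real.exp (∑ l, θ l * Real.pi / 2 * ‖z l‖ ^ 2)) :
    (fun ξ => bargmannConst m * ∫ z, kacIntegrand J β (bargmann (rootCoupling β J) g) ξ z)
      =ᵐ[volume] g := by
  set F := bargmann (rootCoupling β J) g
  have hFd : Differentiable ℂ F := differentiable_bargmann _ g
  have hprod := integrable_exp_mul_kacIntegrand hFd.continuous h0 h1 hD
  -- The rescaled function lives in the Fock space with weight `e^{-π|z|²}`, whose total mass is
  -- `1`.
  set F1 : (Fin m → ℂ) → ℂ := fun z => F fun l => (invAlpha β J l)⁻¹ * z l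
  have hF1 : Differentiable ℂ F1 := hFd.comp (by fun_prop)
  have hF1m : MemLp F1 2 (fockMeasure (1 : Fin m → ℂ)) :=
    memLp_fockMeasure_of_norm_le (fun _ => one_ne_zero) hF1.continuous (D := D) (b := 0) h1
      fun z => by simpa using hD z
  have hpi : (√Real.pi : ℂ) ≠ 0 := by exact_mod_cast (Real.sqrt_pos.2 Real.pi_pos).ne'
  have hpi2 : (Real.pi : ℂ) = √Real.pi * √Real.pi := by
    rw [← Complex.ofReal_mul, Real.mul_self_sqrt Real.pi_pos.le]
  have key : ∀ y : Fin m → ℝ, ∫ ξ, bargmannKernel (fun l => Complex.I * y l) ξ *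
      ∫ z, kacIntegrand J β F ξ z = ((2 * Real.pi : ℝ) : ℂ) ^ ((m : ℂ) / 2) *
        (bargmannConst m * ∫ ξ, bargmannKernel (fun l => Complex.I * y l) ξ * g ξ) := by
    intro y
    set w : Fin m → ℂ := fun l => Complex.I * y l / √Real.pi
    have hw : F1 w = bargmannConst m *
        ∫ ξ, bargmannKernel (fun l => Complex.I * y l) ξ * g ξ := by
      have : (fun l => rootCoupling β J l * ((invAlpha β J l)⁻¹ * w l)) =
          fun l => Complex.I * y l := funext fun l => by
        have := rootCoupling_ne_zero hβ hJ l
        simp only [w, invAlpha]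
        field_simp
      simp only [F1, F, bargmann, this]
    have hrep := integral_mul_conj_fockKernel (α := 1) (fun _ => one_ne_zero) hF1 hF1m w
    rw [fockMeasure_one_real_univ, Complex.ofReal_one, one_mul, integral_fockMeasure, hw] at hrep
    rw [← hrep]
    have hint : Integrable (Function.uncurry fun (ξ : Fin m → ℝ) (z : Fin m → ℂ) =>
        bargmannKernel (fun l => Complex.I * y l) ξ * kacIntegrand J β F ξ z)
        (volume.prod volume) := by
      have hb : Integrable (fun p : (Fin m → ℝ) × (Fin m → ℂ) =>
          (((Real.exp (-(1 / 4) * ∑ l, p.1 l ^ 2) : ℝ) : ℂ) * kacIntegrand J β F p.1 p.2) *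
          Complex.exp (Complex.I * ∑ l, (y l : ℂ) * p.1 l)) (volume.prod volume) := by
        refine hprod.mul_bdd (c := 1) (Continuous.aestronglyMeasurable (by fun_prop))
          (Filter.Eventually.of_forall fun p => ?_)
        rw [Complex.norm_exp]
        have : (Complex.I * ∑ l, (y l : ℂ) * p.1 l) =
            ((∑ l, y l * p.1 l : ℝ) : ℂ) * Complex.I := by push_cast; ring
        rw [this]
        simp
      refine (hb.const_mul (Complex.exp (∑ l, (y l : ℂ) ^ 2 / 2))).congr
        (Filter.Eventually.of_forall fun p => ?_)
      simp only [Function.uncurry, bargmannKernel_I_mul]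
      ring
    simp_rw [← integral_const_mul]
    rw [integral_integral_swap hint]
    refine integral_congr_ae (Filter.Eventually.of_forall fun z => ?_)
    dsimp only
    simp_rw [kacIntegrand_eq]
    calc ∫ ξ, bargmannKernel (fun l => Complex.I * y l) ξ * (F1 z *
          (starRingEnd ℂ (bargmannKernel (fun l => √Real.pi * z l) ξ) *
            Complex.exp (-fockPairing 1 z z)))
        = (F1 z * Complex.exp (-fockPairing 1 z z)) *
          ∫ ξ, bargmannKernel (fun l => Complex.I * y l) ξ *
            starRingEnd ℂ (bargmannKernel (fun l => √Real.pi * z l) ξ) := by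
          rw [← integral_const_mul]
          refine integral_congr_ae (Filter.Eventually.of_forall fun ξ => ?_)
          dsimp only
          ring
      _ = _ := by
          have : Complex.exp (∑ l, Complex.I * y l * starRingEnd ℂ (√Real.pi * z l)) =
              starRingEnd ℂ (fockKernel 1 w z) := by
            rw [conj_fockKernel, fockKernel, fockPairing, Finset.mul_sum]
            congr 1
            refine Finset.sum_congr rfl fun l _ => ?_
            simp only [w, Pi.one_apply, one_mul, map_mul, Complex.conj_ofReal, hpi2]
            field_simp
          rw [integral_bargmannKernel_mul_conj, this]
          ring
  have hL := hprod.integral_prod_left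
  have hL' : Integrable fun ξ => ((Real.exp (-(1 / 4) * ∑ l, ξ l ^ 2) : ℝ) : ℂ) *
      (bargmannConst m * ∫ z, kacIntegrand J β F ξ z) := by
    refine (hL.const_mul (bargmannConst m : ℂ)).congr (Filter.Eventually.of_forall fun ξ => ?_)
    dsimp only
    rw [integral_const_mul]
    ring
  have hg' : Integrable fun ξ => ((Real.exp (-(1 / 4) * ∑ l, ξ l ^ 2) : ℝ) : ℂ) * g ξ := by
    refine (integrable_bargmannKernel_mul 0 g).congr (Filter.Eventually.of_forall fun ξ => ?_)
    have h := bargmannKernel_I_mul (0 : Fin m → ℝ) ξ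
    simp only [Pi.zero_apply, Complex.ofReal_zero, mul_zero, zero_mul, Finset.sum_const_zero,
      Complex.exp_zero, mul_one, one_mul, ne_eq, OfNat.ofNat_ne_zero, not_false_eq_true, zero_pow,
      zero_div] at h
    dsimp only
    rw [← h]
    rfl
  have hfin := ae_eq_zero_of_forall_integral_bargmannKernel_eq_zero
    (h := fun ξ => bargmannConst m * (∫ z, kacIntegrand J β F ξ z) - g ξ) (by
      refine (hL'.sub hg').congr (Filter.Eventually.of_forall fun ξ => ?_)
      simp only [Pi.sub_apply, mul_sub]) fun y => by
    have i2 := integrable_bargmannKernel_mul (fun l => Complex.I * y l) g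
    have i1 : Integrable fun ξ => bargmannKernel (fun l => Complex.I * y l) ξ *
        (bargmannConst m * ∫ z, kacIntegrand J β F ξ z) := by
      refine ((integrable_mul_cexp_dot hL' y).const_mul
        (Complex.exp (∑ l, (y l : ℂ) ^ 2 / 2))).congr (Filter.Eventually.of_forall fun ξ => ?_)
      simp only [bargmannKernel_I_mul]
      ring
    simp_rw [mul_sub]
    rw [integral_sub i1 i2]
    simp_rw [mul_left_comm _ (bargmannConst m : ℂ)]
    rw [integral_const_mul, key]
    linear_combination (∫ ξ, bargmannKernel (fun l => Complex.I * y l) ξ * g ξ) *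
      two_pi_cpow_mul_bargmannConst_sq (m := m)
  filter_upwards [hfin] with ξ h
  exact sub_eq_zero.1 h

theorem norm_scaled_le_of_norm_le (hβ : β ≠ 0) (hJ : ∀ l, 0 < J l) {F : (Fin m → ℂ) → ℂ} {D : ℝ}
    {θ : Fin m → ℝ} (h : ∀ z, ‖F z‖ ≤
      D * Real.exp (∑ l, θ l / 2 * (‖rootCoupling β J l‖ ^ 2 * ‖z l‖ ^ 2))) (z : Fin m → ℂ) :
    ‖F fun l => (invAlpha β J l)⁻¹ * z l‖ ≤
      D * Real.exp (∑ l, θ l * Real.pi / 2 * ‖z l‖ ^ 2) := by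
  refine (h _).trans (le_of_eq ?_)
  congr 2
  refine Finset.sum_congr rfl fun l _ => ?_
  have h1 := pi_mul_norm_invAlpha_mul_sq (β := β) (J := J) (fun l => (invAlpha β J l)⁻¹ * z l) l
  have hα : invAlpha β J l ≠ 0 := div_ne_zero (rootCoupling_ne_zero hβ hJ l)
    (by exact_mod_cast (Real.sqrt_pos.2 Real.pi_pos).ne')
  rw [mul_inv_cancel_left₀ hα] at h1
  rw [← h1]
  ring

end Inversion

/-! ### The formula for `F` as a Bargmann transform -/

section Ruelle

variable {J : Fin m → ℝ} {β : ℂ}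

theorem ruelleIntegrand_eq (f : (Fin m → ℝ) → ℂ) (z : Fin m → ℂ) (x : Fin m → ℝ) :
    ruelleIntegrand J β f z x = (fun ξ => bargmannKernel (fun l => rootCoupling β J l * z l) ξ *
      (sqrtCoshRoot β J ξ * f ξ)) ((2 * √Real.pi) • x) := by
  have h : (√Real.pi : ℂ) ^ 2 = Real.pi := by
    rw [← Complex.ofReal_pow, Real.sq_sqrt Real.pi_pos.le]
  have hx : ((2 * √Real.pi) • x) = fun l => 2 * √Real.pi * x l := rfl
  simp only [ruelleIntegrand, hx]
  rw [mul_comm]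
  congr 1
  rw [bargmannKernel]
  congr 1
  simp only [Finset.mul_sum]
  rw [← Finset.sum_sub_distrib, ← Finset.sum_sub_distrib]
  refine Finset.sum_congr rfl fun l _ => ?_
  rw [mul_pow (rootCoupling β J l), rootCoupling_sq]
  push_cast
  rw [← h]
  ring

/-- The substitution `ξ = 2√π x` has Jacobian `(4π)^{m/2}`, and `(8π)^{m/4} = (2π)^{-m/4}
(4π)^{m/2}`. -/
theorem toRuelle_eq_bargmann {f g : L2 m}
    (hfg : ∀ᵐ ξ, sqrtCoshRoot β J ξ * f ξ = g ξ) (z : Fin m → ℂ) :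
    Integrable (ruelleIntegrand J β f z) ∧
      toRuelle J β f z = bargmann (rootCoupling β J) g z := by
  have hR : (0 : ℝ) < 2 * √Real.pi := by have := Real.pi_pos; positivity
  have hae : (fun ξ => bargmannKernel (fun l => rootCoupling β J l * z l) ξ * g ξ) =ᵐ[volume]
      fun ξ => bargmannKernel (fun l => rootCoupling β J l * z l) ξ *
        (sqrtCoshRoot β J ξ * f ξ) := by
    filter_upwards [hfg] with ξ h
    rw [h]
  have heq : ruelleIntegrand J β f z = fun x => (fun ξ =>
      bargmannKernel (fun l => rootCoupling β J l * z l) ξ *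
      (sqrtCoshRoot β J ξ * f ξ)) ((2 * √Real.pi) • x) := funext fun x => ruelleIntegrand_eq _ z x
  refine ⟨?_, ?_⟩
  · rw [heq]
    exact ((integrable_bargmannKernel_mul _ g).congr hae).comp_smul hR.ne'
  · rw [toRuelle, heq, Measure.integral_comp_smul, bargmann, integral_congr_ae hae,
      Complex.real_smul, ← mul_assoc, ← Complex.ofReal_mul]
    congr 2
    rw [Module.finrank_fin_fun, abs_of_pos (by positivity), bargmannConst]
    have h1 : (2 * √Real.pi) ^ m = (4 * Real.pi) ^ ((m : ℝ) / 2) := by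
      rw [← Real.rpow_natCast, show (2 * √Real.pi) = (4 * Real.pi) ^ (1 / 2 : ℝ) by
        rw [← Real.sqrt_eq_rpow, Real.sqrt_mul (by norm_num), show (4 : ℝ) = 2 ^ 2 by norm_num,
          Real.sqrt_sq zero_le_two], ← Real.rpow_mul (by positivity)]
      congr 1; ring
    have h2 : (4 * Real.pi) ^ ((m : ℝ) / 2) = ((4 * Real.pi) ^ 2) ^ ((m : ℝ) / 4) := by
      rw [← Real.rpow_natCast, ← Real.rpow_mul (by positivity)]
      congr 1; push_cast; ring
    rw [h1, h2, ← Real.inv_rpow (by positivity), ← Real.mul_rpow (by positivity) (by positivity)]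
    congr 1
    have := Real.pi_pos
    field_simp
    norm_num

end Ruelle

/-! ### Matching eigenfunctions through `g = √c f` -/

section Eigenfunctions

variable {lam J : Fin m → ℝ} {β : ℂ}

theorem exists_isIntegralOperator_coshRoot (hlam : ∀ l, 0 < lam l ∧ lam l < 1) (J : Fin m → ℝ)
    (β : ℂ) {φ ψ : (Fin m → ℝ) → ℂ} (hφ : φ = coshRoot β J ∨ φ = sqrtCoshRoot β J)
    (hψ : ψ = sqrtCoshRoot β J ∨ ψ = fun _ => 1) :
    ∃ T : L2 m →L[ℂ] L2 m, IsIntegralOperator (fun ξ η =>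
      normalization lam J β * φ ξ * (kernelTilde lam ξ η : ℂ) * ψ η) T := by
  obtain ⟨C, hC⟩ := exists_coshRoot_bound hlam β J
  have hφ' : Measurable φ ∧ ∀ ξ, ‖φ ξ‖ * gaussWeight lam ξ ≤ C := by
    rcases hφ with rfl | rfl
    · exact ⟨(continuous_coshRoot β J).measurable, fun ξ => (hC ξ).1⟩
    · exact ⟨measurable_sqrtCoshRoot β J, fun ξ => (hC ξ).2⟩
  have hψ' : Measurable ψ ∧ ∃ B, ∀ ξ, ‖ψ ξ‖ * gaussWeight lam ξ ≤ B := by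
    rcases hψ with rfl | rfl
    · exact ⟨measurable_sqrtCoshRoot β J, C, fun ξ => (hC ξ).2⟩
    · exact ⟨measurable_const, 1, fun ξ => by simpa using gaussWeight_le_one hlam ξ⟩
  obtain ⟨B, hB⟩ := hψ'.2
  refine exists_isIntegralOperator_mul_kernelTilde_mul hlam (hφ'.1.const_mul _) hψ'.1
    ⟨‖normalization lam J β‖ * C, fun ξ => ?_⟩ ⟨B, fun ξ => ?_⟩
  · refine mul_gaussWeight_pow_three_le hlam 1 (by norm_num) (norm_nonneg _) ?_
    rw [norm_mul, mul_assoc, pow_one]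
    exact mul_le_mul_of_nonneg_left (hφ'.2 ξ) (norm_nonneg _)
  · exact mul_gaussWeight_pow_three_le hlam 1 (by norm_num) (norm_nonneg _) (by
      rw [pow_one]; exact hB ξ)

variable {G Gt : L2 m →L[ℂ] L2 m} {ρ : ℂ}

/-- Dividing `g` by `√c`, which may have zeros, need not visibly give an `L²` function. The
eigenvalue equation `ρ g = c K g` supplies the quotient as `ρ⁻¹ √c K g`, with `√c K` a bounded
operator. -/
theorem exists_rescaled_eigen (hlam : ∀ l, 0 < lam l ∧ lam l < 1)
    (hG : IsIntegralOperator (kernelRescaled lam J β) G)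
    (hGt : IsIntegralOperator (kernelModified lam J β) Gt) (hρ : ρ ≠ 0) {g : L2 m}
    (hg : Gt g = ρ • g) :
    ∃ f : L2 m, (∀ᵐ ξ, sqrtCoshRoot β J ξ * f ξ = g ξ) ∧ G f = ρ • f := by
  obtain ⟨A, hA⟩ := exists_isIntegralOperator_coshRoot (ψ := fun _ => 1) hlam J β
    (Or.inr rfl) (Or.inr rfl)
  have hfA : ρ • (ρ⁻¹ • A g) = A g := smul_inv_smul₀ hρ _
  have hfg : ∀ᵐ ξ, sqrtCoshRoot β J ξ * (ρ⁻¹ • A g : L2 m) ξ = g ξ := by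
    have h1 := (hGt g).2
    rw [hg] at h1
    filter_upwards [h1, (hA g).2, Lp.coeFn_smul ρ⁻¹ (A g), Lp.coeFn_smul ρ g] with ξ e1 e2 e3 e4
    rw [e3, Pi.smul_apply, smul_eq_mul, mul_left_comm, inv_mul_eq_iff_eq_mul₀ hρ, ← smul_eq_mul ρ,
      ← Pi.smul_apply ρ, ← e4, e1, e2, ← integral_const_mul]
    refine integral_congr_ae (Filter.Eventually.of_forall fun η => ?_)
    simp only [kernelModified, ← sqrtCoshRoot_mul_self]
    ring
  refine ⟨ρ⁻¹ • A g, hfg, Lp.ext ?_⟩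
  rw [hfA]
  filter_upwards [(hG (ρ⁻¹ • A g)).2, (hA g).2] with ξ e1 e2
  rw [e1, e2]
  refine integral_congr_ae ?_
  filter_upwards [hfg] with η e3
  rw [kernelRescaled_eq, mul_one, mul_assoc, e3]

/-- The factor `√c` may be unbounded, but `ρ f = √c K √c f` gives `√c f = ρ⁻¹ c K √c f`, and `c K
√c` is bounded on `L²`. -/
theorem exists_modified_eigen (hlam : ∀ l, 0 < lam l ∧ lam l < 1)
    (hG : IsIntegralOperator (kernelRescaled lam J β) G)
    (hGt : IsIntegralOperator (kernelModified lam J β) Gt) (hρ : ρ ≠ 0) {f : L2 m}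
    (hf : G f = ρ • f) :
    ∃ g : L2 m, (∀ᵐ ξ, sqrtCoshRoot β J ξ * f ξ = g ξ) ∧ Gt g = ρ • g := by
  obtain ⟨A, hA⟩ := exists_isIntegralOperator_coshRoot hlam J β (Or.inl rfl) (Or.inl rfl)
  have hfA : ρ • (ρ⁻¹ • A f) = A f := smul_inv_smul₀ hρ _
  have hfg : ∀ᵐ ξ, sqrtCoshRoot β J ξ * f ξ = (ρ⁻¹ • A f : L2 m) ξ := by
    have h1 := (hG f).2
    rw [hf] at h1
    filter_upwards [h1, (hA f).2, Lp.coeFn_smul ρ⁻¹ (A f), Lp.coeFn_smul ρ f] with ξ e1 e2 e3 e4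
    rw [e3, Pi.smul_apply, smul_eq_mul, eq_inv_mul_iff_mul_eq₀ hρ, mul_left_comm,
      ← smul_eq_mul ρ, ← Pi.smul_apply ρ, ← e4, e1, e2, ← integral_const_mul]
    refine integral_congr_ae (Filter.Eventually.of_forall fun η => ?_)
    simp only [kernelRescaled_eq, ← sqrtCoshRoot_mul_self β J ξ]
    ring
  refine ⟨ρ⁻¹ • A f, hfg, Lp.ext ?_⟩
  rw [hfA]
  filter_upwards [(hGt (ρ⁻¹ • A f)).2, (hA f).2] with ξ e1 e2
  rw [e1, e2]
  refine integral_congr_ae ?_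
  filter_upwards [hfg] with η e3
  rw [kernelModified, ← e3, mul_assoc _ (sqrtCoshRoot β J η)]

theorem ne_zero_iff_of_ae_sqrtCoshRoot_mul_eq (hm : 0 < m) (hβ : β ≠ 0) (hJ : ∀ l, 0 < J l)
    {f g : L2 m} (hfg : ∀ᵐ ξ, sqrtCoshRoot β J ξ * f ξ = g ξ) : f ≠ 0 ↔ g ≠ 0 := by
  refine not_congr ⟨fun h => ?_, fun h => ?_⟩
  · subst h
    refine Lp.ext ?_
    filter_upwards [hfg, Lp.coeFn_zero ℂ 2 (volume : Measure (Fin m → ℝ))] with ξ e1 e2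
    rw [← e1, e2, Pi.zero_apply, mul_zero]
  · subst h
    refine Lp.ext ?_
    filter_upwards [hfg, Lp.coeFn_zero ℂ 2 (volume : Measure (Fin m → ℝ)),
      ae_coshRoot_ne_zero hm hβ hJ] with ξ e1 e2 e3
    rw [e2, Pi.zero_apply, mul_eq_zero] at e1
    rw [e2, e1.resolve_left (sqrtCoshRoot_ne_zero e3), Pi.zero_apply]

/-- The inversion formula, available because eigenfunctions have subcritical growth, returns `g`;
dividing by `√c` is harmless off a null set. -/
theorem toKac_of_eigen (hm : 0 < m) (hβ : β ≠ 0) (hJ : ∀ l, 0 < J l)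
    (hlam : ∀ l, 0 < lam l ∧ lam l < 1) {L : Fock (invAlpha β J) →L[ℂ] Fock (invAlpha β J)}
    (hL : IsRuelleOperator lam J β L) (hρ : ρ ≠ 0) {F : Fock (invAlpha β J)}
    (hF : L F = ρ • F) {f g : L2 m} (hfg : ∀ᵐ ξ, sqrtCoshRoot β J ξ * f ξ = g ξ)
    (hFg : Fock.fn _ F = bargmann (rootCoupling β J) g) :
    (∀ ξ, Integrable (kacIntegrand J β F ξ)) ∧ f =ᵐ[volume] toKac J β F := by
  obtain ⟨D, hD⟩ := exists_norm_apply_le_of_eigen hlam hβ hJ hL hρ hF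
  have h0 : ∀ l, 0 ≤ (1 + lam l ^ 2) / 2 := fun l => by positivity
  have h1 : ∀ l, (1 + lam l ^ 2) / 2 < 1 := fun l => by nlinarith [hlam l]
  have hD' := norm_scaled_le_of_norm_le hβ hJ hD
  refine ⟨fun ξ => integrable_kacIntegrand F.differentiable.continuous h0 h1 hD' ξ, ?_⟩
  rw [hFg] at hD' ⊢
  filter_upwards [bargmannConst_mul_integral_kacIntegrand hβ hJ h0 h1 g hD', hfg,
    ae_coshRoot_ne_zero hm hβ hJ] with ξ e1 e2 e3
  have e4 := sqrtCoshRoot_ne_zero e3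
  rw [toKac, mul_right_comm]
  change f ξ = bargmannConst m * _ * _
  rw [e1, ← e2]
  field_simp

end Eigenfunctions

end KacBaker
end

/-! ### The theorem -/

theorem theorem1 (m : ℕ) (hm : 0 < m) (J lam : Fin m → ℝ) (hJ : ∀ l, 0 < J l)
    (hlam : ∀ l, 0 < lam l ∧ lam l < 1) (β : ℂ) (hβ : β ≠ 0) :
    ∃ (L : Fock (KacBaker.invAlpha β J) →L[ℂ] Fock (KacBaker.invAlpha β J))
      (Gt : KacBaker.L2 m →L[ℂ] KacBaker.L2 m),
      KacBaker.IsRuelleOperator lam J β L ∧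
      KacBaker.IsIntegralOperator (KacBaker.kernelModified lam J β) Gt ∧
      spectrum ℂ L = spectrum ℂ Gt ∧
      (β.im = 0 →
        ∃ G : KacBaker.L2 m →L[ℂ] KacBaker.L2 m,
          KacBaker.IsIntegralOperator (KacBaker.kernelRescaled lam J β) G ∧
          spectrum ℂ G = spectrum ℂ L ∧
          ∀ ρ : ℂ, ρ ≠ 0 →
            (∀ F : Fock (KacBaker.invAlpha β J),
              Module.End.HasEigenvector (L : Module.End ℂ (Fock (KacBaker.invAlpha β J))) ρ F →
                (∀ ξ, MeasureTheory.Integrable (KacBaker.kacIntegrand J β F ξ)) ∧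
                ∃ f : KacBaker.L2 m,
                  f =ᵐ[MeasureTheory.volume] KacBaker.toKac J β F ∧
                  Module.End.HasEigenvector (G : Module.End ℂ (KacBaker.L2 m)) ρ f ∧
                  ∀ z, F z = KacBaker.toRuelle J β f z) ∧
            (∀ f : KacBaker.L2 m,
              Module.End.HasEigenvector (G : Module.End ℂ (KacBaker.L2 m)) ρ f →
                (∀ z, MeasureTheory.Integrable (KacBaker.ruelleIntegrand J β f z)) ∧
                ∃ F : Fock (KacBaker.invAlpha β J),
                  (∀ z, F z = KacBaker.toRuelle J β f z) ∧
                  Module.End.HasEigenvector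
                    (L : Module.End ℂ (Fock (KacBaker.invAlpha β J))) ρ F ∧
                  f =ᵐ[MeasureTheory.volume] KacBaker.toKac J β F)) := by
  have hs := KacBaker.rootCoupling_ne_zero hβ hJ
  let e := bargmannEquiv (α := KacBaker.invAlpha β J) (s := KacBaker.rootCoupling β J)
    (fun _ => rfl) hs
  have he : ∀ g, Fock.fn _ (e g) = bargmann (KacBaker.rootCoupling β J) g := fun _ => rfl
  obtain ⟨Gt, hGt'⟩ := KacBaker.exists_isIntegralOperator_coshRoot (ψ := fun _ => 1) hlam J β
    (Or.inl rfl) (Or.inr rfl)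
  have hGt : KacBaker.IsIntegralOperator (KacBaker.kernelModified lam J β) Gt := by
    simp only [mul_one] at hGt'
    exact hGt'
  obtain ⟨G, hG'⟩ := KacBaker.exists_isIntegralOperator_coshRoot hlam J β
    (Or.inr rfl) (Or.inl rfl)
  have hG : KacBaker.IsIntegralOperator (KacBaker.kernelRescaled lam J β) G := by
    simp only [← KacBaker.kernelRescaled_eq] at hG'
    exact hG'
  -- The Ruelle operator is obtained as the conjugate of `Gt` by the Bargmann isomorphism, so that
  -- it is bounded from the start; its explicit formula is the intertwining identity.
  set L := e.conjContinuousAlgEquiv Gt with hLdef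
  have hLe : ∀ g, L (e g) = e (Gt g) := fun g => by
    rw [hLdef, ContinuousLinearEquiv.conjContinuousAlgEquiv_apply_apply, e.symm_apply_apply]
  have hL : KacBaker.IsRuelleOperator lam J β L := by
    intro F z
    obtain ⟨g, rfl⟩ := e.surjective F
    rw [hLe, he, he]
    exact KacBaker.bargmann_modified hlam J β hGt g z
  have hLs : spectrum ℂ L = spectrum ℂ Gt := AlgEquiv.spectrum_eq e.conjContinuousAlgEquiv Gt
  refine ⟨L, Gt, hL, hGt, hLs, fun _ => ⟨G, hG,
    (KacBaker.spectrum_kernelRescaled_eq hm hlam J β hG hGt).trans hLs.symm, fun ρ hρ =>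
    ⟨fun F hF => ?_, fun f hf => ?_⟩⟩⟩
  · obtain ⟨g, rfl⟩ := e.surjective F
    have hLF : L (e g) = ρ • e g := hF.apply_eq_smul
    have hg : Gt g = ρ • g := e.injective (by rw [← hLe, hLF, map_smul])
    have hg0 : g ≠ 0 := fun h => hF.2 (by rw [h, map_zero])
    obtain ⟨f, hfg, hGf⟩ := KacBaker.exists_rescaled_eigen hlam hG hGt hρ hg
    obtain ⟨h1, h2⟩ := KacBaker.toKac_of_eigen hm hβ hJ hlam hL hρ hLF hfg (he g)
    refine ⟨h1, f, h2, ⟨Module.End.mem_eigenspace_iff.2 hGf,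
      (KacBaker.ne_zero_iff_of_ae_sqrtCoshRoot_mul_eq hm hβ hJ hfg).2 hg0⟩, fun z => ?_⟩
    rw [he, (KacBaker.toRuelle_eq_bargmann hfg z).2]
  · have hGf : G f = ρ • f := hf.apply_eq_smul
    obtain ⟨g, hfg, hg⟩ := KacBaker.exists_modified_eigen hlam hG hGt hρ hGf
    have hg0 : g ≠ 0 := (KacBaker.ne_zero_iff_of_ae_sqrtCoshRoot_mul_eq hm hβ hJ hfg).1 hf.2
    have hLF : L (e g) = ρ • e g := by rw [hLe, hg, map_smul]
    refine ⟨fun z => (KacBaker.toRuelle_eq_bargmann hfg z).1, e g, fun z => ?_,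
      ⟨Module.End.mem_eigenspace_iff.2 hLF, fun h => hg0 (e.injective (by rw [h, map_zero]))⟩,
      (KacBaker.toKac_of_eigen hm hβ hJ hlam hL hρ hLF hfg (he g)).2⟩
    rw [he, (KacBaker.toRuelle_eq_bargmann hfg z).2]
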